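/- **Setting.** For $x,y\in\mathbb R^2$ let $d(x,y)=|x_1-y_1|+\sqrt{|x_2-y_2|}$. For $T>0$ let $\psi_T$ be the (real-valued) Schwartz function on $\mathbb R^2$ with Fourier transform $\int e^{-ik\cdot x}\psi_T(x)\,dx=\exp(-T(k_1^4+k_2^2))$. For a real Banach space $F$, $\mathcal S'(\mathbb R^2;F)$ denotes the continuous linear maps from $\mathcal S(\mathbb R^2)$ to $F$, $\mathcal S'(\mathbb R^2)=\mathcal S'(\mathbb R^2;\mathbb R)$, and for $g\in\mathcal S'(\mathbb R^2;F)$ we write $g_T(x)=\langle g,\psi_T(x-\cdot)\rangle\in F$. Let $\mathsf A\subset\mathbb R$ be finite and non-empty and let $\mathsf T=\bigoplus_{\beta\in\mathsf A}\mathsf T_\beta$ be a direct sum of real Banach spaces. Write $\|\cdot\|$ for the supremum norm over $\mathbb R^2$. A *skeleton* is a continuous map $\Gamma:\mathbb R^2\to\mathcal L(\mathsf T,\mathsf T)$ whose blocks $\Gamma_\beta^\gamma(x)\in\mathcal L(\mathsf T_\gamma,\mathsf T_\beta)$ satisfy $\Gamma_\beta^\gamma=0$ for $\gamma>\beta$ and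 $\Gamma_\beta^\beta=\mathrm{id}$, and for which, with $\Gamma_\beta(x)\mathsf v:=(\Gamma(x)\mathsf v)_\beta$, there is a constant $C\ge0$ such that for all $\beta\in\mathsf A$, $\mathsf v\in\mathsf T$ and all $x,y$ with $d(y,x)\le1$ $$\|(\Gamma_\beta(y)-\Gamma_\beta(x))\mathsf v\|_{\mathsf T_\beta}\le C\sum_{\gamma<\beta}d^{\beta-\gamma}(y,x)\,\|\Gamma_\gamma(x)\mathsf v\|_{\mathsf T_\gamma}.$$ The minimal such $C$ is denoted $\|\Gamma\|_{sk}$. For $\overline\alpha\in\mathbb R$, $\mathcal D^{\overline\alpha}(\mathsf T;\Gamma)$ is the set of continuous maps $V:\mathbb R^2\to\mathsf T^*=\mathcal L(\mathsf T,\mathbb R)$ for which there are constants $M^b_\beta\ge0$ and $M^c\ge0$ with $$|V(x).\mathsf v|\le\sum_{\beta\in\mathsf A}M^b_\beta\|\Gamma_\beta(x)\mathsf v\|_{\mathsf T_\beta}\quad\text{for all }\mathsf v\in\mathsf T,\ x\in\mathbb R^2,$$ $$|(V(y)-V(x)).\mathsf v|\le M^c\sum_{\beta\in\mathsf A}d^{(\overline\alpha-\beta)\vee0}(y,x)\,\|\Gamma_\beta(x)\mathsf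 v\|_{\mathsf T_\beta}\quad\text{for all }\mathsf v\in\mathsf T,\ d(y,x)\le1.$$ The smallest $M^c$ is denoted $[V]_{\mathcal D^{\overline\alpha}(\mathsf T;\Gamma)}$. **Proposition (Reconstruction).** Let $\mathsf A\subset\mathbb R$ be finite and non-empty with $\min\mathsf A\in(-4,0)$, and let $\overline\alpha>0$. There is a constant $C_0>0$, depending only on $\mathsf A$ and $\overline\alpha$, such that the following holds for all Banach spaces $\{\mathsf T_\beta\}_{\beta\in\mathsf A}$, every skeleton $\Gamma$ on $\mathsf T=\bigoplus_\beta\mathsf T_\beta$, every $v\in\mathcal S'(\mathbb R^2;\mathsf T)$ with $$\|\Gamma_\beta(x)v_T(x)\|_{\mathsf T_\beta}\le(T^{\frac14})^\beta\qquad\text{for all }\beta\in\mathsf A,\ x\in\mathbb R^2,\ 0<T\le1,$$ and every $V\in\mathcal D^{\overline\alpha}(\mathsf T;\Gamma)$. There exists $\mathcal RV\in\mathcal S'(\mathbb R^2)$ such that for all $0<T\le1$ $$\|(\mathcal RV)_T-V.v_T\|\le C_0\,(1+\|\Gamma\|_{sk})^{|\mathsf A|-1}\,[V]_{\mathcal D^{\overline\alpha}(\mathsf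 T;\Gamma)}\,(T^{\frac14})^{\overline\alpha},$$ where $|\mathsf A|$ is the number of elements of $\mathsf A$. Moreover, $\mathcal RV$ is unique: any $R'\in\mathcal S'(\mathbb R^2)$ for which there is a constant $C'$ with $\|R'_T-V.v_T\|\le C'(T^{\frac14})^{\overline\alpha}$ for all $0<T\le1$ equals $\mathcal RV$. -/

import Mathlib

open scoped SchwartzMap FourierTransform

noncomputable section

/-! ### The plane, its parabolic distance, and the mollifying semigroup -/

/-- The plane `ℝ²`; the coordinate `x 0` is `x₁` and the coordinate `x 1` is `x₂`. -/
abbrev Plane : Type := EuclideanSpace ℝ (Fin 2)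

/-- The parabolic distance `d(x,y) = |x₁ - y₁| + √|x₂ - y₂|`. -/
def parabolicDist (x y : Plane) : ℝ := |x 0 - y 0| + √|x 1 - y 1|

/-- The polynomial `T (k₁⁴ + k₂²)` at the frequency `k = 2πξ`; Mathlib's Fourier transform uses the
characters `exp(2πi ξ·x)`, so that `ξ` has to be rescaled to obtain the symbol of
`T (∂₁⁴ - ∂₂²)`. -/
def symbolExponent (T : ℝ) (ξ : Plane) : ℝ :=
  T * ((2 * Real.pi * ξ 0) ^ 4 + (2 * Real.pi * ξ 1) ^ 2)

lemma symbolExponent_hasTemperateGrowth (T : ℝ) :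
    (fun ξ => -symbolExponent T ξ).HasTemperateGrowth := by
  have h0 : (fun ξ : Plane => ξ 0).HasTemperateGrowth :=
    (EuclideanSpace.proj (𝕜 := ℝ) (0 : Fin 2)).hasTemperateGrowth
  have h1 : (fun ξ : Plane => ξ 1).HasTemperateGrowth :=
    (EuclideanSpace.proj (𝕜 := ℝ) (1 : Fin 2)).hasTemperateGrowth
  have c (a : ℝ) : (fun _ : Plane => a).HasTemperateGrowth := .const a
  exact ((c T).mul ((((c (2 * Real.pi)).mul h0).pow 4).add (((c (2 * Real.pi)).mul h1).pow 2))).neg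

lemma symbolExponent_lower {T : ℝ} (hT : 0 < T) (ξ : Plane) :
    2 * T * (1 + ‖ξ‖) - 4 * T ≤ symbolExponent T ξ := by
  have hn : ‖ξ‖ ^ 2 = ξ 0 ^ 2 + ξ 1 ^ 2 := by
    simp [EuclideanSpace.norm_sq_eq, Fin.sum_univ_two]
  have hpi : 1 ≤ 2 * Real.pi := by linarith [Real.pi_gt_three]
  have hpi2 : 1 ≤ (2 * Real.pi) ^ 2 := one_le_pow₀ hpi
  have h0 : ξ 0 ^ 2 ≤ (2 * Real.pi * ξ 0) ^ 2 := by
    rw [mul_pow]; exact le_mul_of_one_le_left (sq_nonneg _) hpi2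
  have h1 : ξ 1 ^ 2 ≤ (2 * Real.pi * ξ 1) ^ 2 := by
    rw [mul_pow]; exact le_mul_of_one_le_left (sq_nonneg _) hpi2
  have h2 : 2 * (1 + ‖ξ‖) - 4 ≤ (2 * Real.pi * ξ 0) ^ 4 + (2 * Real.pi * ξ 1) ^ 2 := by
    nlinarith [sq_nonneg (‖ξ‖ - 1), sq_nonneg ((2 * Real.pi * ξ 0) ^ 2 - 1 / 2)]
  unfold symbolExponent
  nlinarith

lemma symbol_decay {T : ℝ} (hT : 0 < T) (k n : ℕ) :
    ∃ C, ∀ ξ : Plane,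
      ‖ξ‖ ^ k * ‖iteratedFDeriv ℝ n (fun ξ => Real.exp (-symbolExponent T ξ)) ξ‖ ≤ C := by
  have htg := symbolExponent_hasTemperateGrowth T
  obtain ⟨m, C, hC0, hC⟩ := htg.norm_iteratedFDeriv_le_uniform n
  set M := k + m * n with hM
  refine ⟨n.factorial * (C + 1) ^ n * (M.factorial / (2 * T) ^ M * Real.exp (4 * T)), fun ξ => ?_⟩
  set r := 1 + ‖ξ‖ with hr
  have hr1 : 1 ≤ r := by have := norm_nonneg ξ; linarith
  have hD1 : 1 ≤ (C + 1) * r ^ m := by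
    have : 1 ≤ r ^ m := one_le_pow₀ hr1
    nlinarith
  have key : ‖iteratedFDeriv ℝ n (Real.exp ∘ fun ξ => -symbolExponent T ξ) ξ‖
      ≤ n.factorial * Real.exp (-symbolExponent T ξ) * ((C + 1) * r ^ m) ^ n := by
    refine norm_iteratedFDeriv_comp_le (N := ((n : ℕ∞) : WithTop ℕ∞)) Real.contDiff_exp
      (htg.1.of_le (by exact_mod_cast le_top)) le_rfl ξ ?_ ?_
    · intro i _
      rw [norm_iteratedFDeriv_eq_norm_iteratedDeriv, iteratedDeriv_eq_iterate, Real.iter_deriv_exp]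
      simp [abs_of_pos, Real.exp_pos]
    · intro i hi1 hin
      calc _ ≤ C * r ^ m := hC i hin ξ
        _ ≤ (C + 1) * r ^ m := by gcongr; linarith
        _ ≤ _ := le_self_pow₀ hD1 (by omega)
  have hexp : r ^ M * Real.exp (-symbolExponent T ξ)
      ≤ M.factorial / (2 * T) ^ M * Real.exp (4 * T) := by
    have h1 := Real.pow_div_factorial_le_exp (2 * T * r) (by positivity) M
    have h2 : Real.exp (-symbolExponent T ξ) ≤ Real.exp (4 * T) / Real.exp (2 * T * r) := by
      rw [← Real.exp_sub]
      exact Real.exp_le_exp.2 (by linarith [symbolExponent_lower hT ξ])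
    have h3 : r ^ M ≤ M.factorial / (2 * T) ^ M * Real.exp (2 * T * r) := by
      rw [mul_pow, div_le_iff₀ (by positivity)] at h1
      rw [div_mul_eq_mul_div, le_div_iff₀ (by positivity)]
      linarith
    calc _ ≤ (M.factorial / (2 * T) ^ M * Real.exp (2 * T * r)) *
          (Real.exp (4 * T) / Real.exp (2 * T * r)) := by gcongr
      _ = _ := by field_simp
  calc ‖ξ‖ ^ k * ‖iteratedFDeriv ℝ n (fun ξ => Real.exp (-symbolExponent T ξ)) ξ‖
      ≤ r ^ k * (n.factorial * Real.exp (-symbolExponent T ξ) * ((C + 1) * r ^ m) ^ n) := by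
        gcongr
        · linarith
        · exact key
    _ = n.factorial * (C + 1) ^ n * (r ^ M * Real.exp (-symbolExponent T ξ)) := by
        rw [hM, mul_pow, ← pow_mul, pow_add]; ring
    _ ≤ _ := by gcongr

/-- The symbol `k ↦ exp(-T (k₁⁴ + k₂²))`, `k = 2πξ`, as a Schwartz function of `ξ`, for `T > 0`.
(For `T ≤ 0` it is not a Schwartz function, and the value `0` is a convention which is never
used.) -/
def semigroupSymbol (T : ℝ) : 𝓢(Plane, ℝ) :=
  if hT : 0 < T then
    { toFun := fun ξ => Real.exp (-symbolExponent T ξ)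
      smooth' := Real.contDiff_exp.comp (symbolExponent_hasTemperateGrowth T).1
      decay' := symbol_decay hT }
  else 0

/-- The convolution kernel `ψ_T` of the semigroup `exp(-T (∂₁⁴ - ∂₂²))`, `T > 0`, i.e. the Schwartz
function with Fourier transform `exp(-T (k₁⁴ + k₂²))`. The inverse Fourier transform is real valued
since the symbol is real and even; taking its real part only changes the type of the values. -/
def heatKernel (T : ℝ) : 𝓢(Plane, ℝ) :=
  SchwartzMap.postcompCLM Complex.reCLM
    (𝓕⁻ (SchwartzMap.postcompCLM Complex.ofRealCLM (semigroupSymbol T)))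

/-- The Schwartz function `y ↦ ψ_T(x - y)`. -/
def heatKernelAt (T : ℝ) (x : Plane) : 𝓢(Plane, ℝ) :=
  SchwartzMap.compSubConstCLM ℝ x
    (SchwartzMap.compCLMOfContinuousLinearEquiv ℝ (ContinuousLinearEquiv.neg ℝ) (heatKernel T))

lemma heatKernelAt_apply (T : ℝ) (x y : Plane) : heatKernelAt T x y = heatKernel T (x - y) := by
  simp [heatKernelAt]

/-- The space `𝒮'(ℝ²; F)` of (real) tempered distributions with values in a normed space `F`:
continuous linear maps from the Schwartz space to `F`. -/
abbrev TemperedDist (F : Type*) [NormedAddCommGroup F] [NormedSpace ℝ F] : Type _ :=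
  𝓢(Plane, ℝ) →L[ℝ] F

/-- The mollification `g_T(x) = ⟨g, ψ_T(x - ·)⟩` of a tempered distribution `g`. -/
def mollify {F : Type*} [NormedAddCommGroup F] [NormedSpace ℝ F]
    (g : TemperedDist F) (T : ℝ) (x : Plane) : F :=
  g (heatKernelAt T x)

/-! ### Skeletons and modelled distributions

The abstract space is given by a finite set `A ⊂ ℝ` of homogeneities and a family `E β`, `β ∈ A`, of
real Banach spaces; the graded space is the finite direct sum `⨁ E β = ∀ β : A, E β`. -/

section Modelled

variable {A : Finset ℝ} {E : A → Type*} [∀ β, NormedAddCommGroup (E β)] [∀ β, NormedSpace ℝ (E β)]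

/-- The block `L_β^γ ∈ ℒ(E γ, E β)` of an endomorphism `L` of the direct sum. -/
def block (L : (∀ β, E β) →L[ℝ] (∀ β, E β)) (β γ : A) : E γ →L[ℝ] E β :=
  (ContinuousLinearMap.proj (R := ℝ) (φ := E) β) ∘L L ∘L (ContinuousLinearMap.single ℝ E γ)

/-- The continuity property of a skeleton with the constant `C`:
`‖(Γ_β(y) - Γ_β(x)) v‖ ≤ C ∑_{γ < β} d(y,x)^{β-γ} ‖Γ_γ(x) v‖` whenever `d(y,x) ≤ 1`. -/
def SkeletonContinuityWith (Γ : Plane → (∀ β, E β) →L[ℝ] (∀ β, E β)) (C : ℝ) : Prop :=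
  ∀ (β : A) (v : ∀ β, E β) (x y : Plane), parabolicDist y x ≤ 1 →
    ‖Γ y v β - Γ x v β‖ ≤
      C * ∑ γ : A with γ < β, parabolicDist y x ^ ((β : ℝ) - (γ : ℝ)) * ‖Γ x v γ‖

/-- `Γ ∈ C⁰(ℝ²; ℒ(⨁ E β, ⨁ E β))` is a skeleton: it is lower triangular with identities on the
diagonal, and it has the continuity property with some constant. -/
structure IsSkeleton (Γ : Plane → (∀ β, E β) →L[ℝ] (∀ β, E β)) : Prop where
  continuous : Continuous Γ
  block_eq_zero : ∀ (x : Plane) (β γ : A), β < γ → block (Γ x) β γ = 0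
  block_self : ∀ (x : Plane) (β : A), block (Γ x) β β = ContinuousLinearMap.id ℝ (E β)
  exists_continuityWith : ∃ C : ℝ, 0 ≤ C ∧ SkeletonContinuityWith Γ C

/-- `‖Γ‖_sk`, the minimal constant in the continuity property of the skeleton. -/
def skeletonNorm (Γ : Plane → (∀ β, E β) →L[ℝ] (∀ β, E β)) : ℝ :=
  sInf {C : ℝ | 0 ≤ C ∧ SkeletonContinuityWith Γ C}

/-- Form boundedness with the constants `M_β`: `|V(x).v| ≤ ∑_β M_β ‖Γ_β(x) v‖`. -/
def FormBoundedWith (Γ : Plane → (∀ β, E β) →L[ℝ] (∀ β, E β)) (V : Plane → (∀ β, E β) →L[ℝ] ℝ)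
    (M : A → ℝ) : Prop :=
  ∀ (v : ∀ β, E β) (x : Plane), |V x v| ≤ ∑ β : A, M β * ‖Γ x v β‖

/-- Form continuity of order `α` with the constant `M`:
`|(V(y) - V(x)).v| ≤ M ∑_β d(y,x)^{(α-β) ∨ 0} ‖Γ_β(x) v‖` whenever `d(y,x) ≤ 1`. -/
def FormContinuousWith (Γ : Plane → (∀ β, E β) →L[ℝ] (∀ β, E β)) (α : ℝ)
    (V : Plane → (∀ β, E β) →L[ℝ] ℝ) (M : ℝ) : Prop :=
  ∀ (v : ∀ β, E β) (x y : Plane), parabolicDist y x ≤ 1 →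
    |V y v - V x v| ≤ M * ∑ β : A, parabolicDist y x ^ max (α - (β : ℝ)) 0 * ‖Γ x v β‖

/-- `V ∈ C⁰(ℝ²; (⨁ E β)^*)` is a modelled distribution of order `α`, i.e. `V ∈ 𝒟^α(E; Γ)`. -/
structure IsModelledDistribution (Γ : Plane → (∀ β, E β) →L[ℝ] (∀ β, E β)) (α : ℝ)
    (V : Plane → (∀ β, E β) →L[ℝ] ℝ) : Prop where
  continuous : Continuous V
  exists_boundedWith : ∃ M : A → ℝ, (∀ β, 0 ≤ M β) ∧ FormBoundedWith Γ V M
  exists_continuousWith : ∃ M : ℝ, 0 ≤ M ∧ FormContinuousWith Γ α V M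

/-- The semi-norm `[V]_{𝒟^α(E; Γ)}`, the smallest constant in the form continuity. -/
def formSeminorm (Γ : Plane → (∀ β, E β) →L[ℝ] (∀ β, E β)) (α : ℝ)
    (V : Plane → (∀ β, E β) →L[ℝ] ℝ) : ℝ :=
  sInf {M : ℝ | 0 ≤ M ∧ FormContinuousWith Γ α V M}

end Modelled

end

/-!
# Reconstruction of modelled distributions

Let `ψ_t` be the kernel of the semigroup `S_t` generated by `∂₂² - ∂₁⁴` and let `v_t`, `f_t` be the
mollification `v_t = v * ψ_t` and the local approximation `f_t(x) = V(x).v_t(x)`. As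
`v_{s+t} = v_t * ψ_s`, the function `f_t * ψ_s - f_{s+t}` is the commutator
`∫ ψ_s(x - y) (V(y) - V(x)).v_t(y) dy`. The form continuity of `V` based at `y`, the size
`t^{β/4}` of the components of `v_t(y)` and the scaling of `ψ_s` bound it by a multiple of `t^{α/4}`
for `s ≤ t` (`abs_integral_commutator_le`). For `d(x,y) > 1` the form continuity is first
extended by subdividing the segment from `y` to `x`: the skeleton property propagates the bound on
`Γ_β v_t` along the subdivision, one homogeneity after the other, with polynomial growth in the
number of steps and one factor `1 + ‖Γ‖_sk` for each homogeneity below `β`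
(`norm_skeleton_chain_le`, `abs_form_sub_le_of_one_le`). The fast decay of `ψ_s` absorbs the growth.

It remains to pass from `f_t` to a distribution (`exists_temperedDist_of_almost_semigroup`). For a
Schwartz function `φ`, the difference of `∫ f_{2t} φ` and `∫ f_t φ` consists of
`∫ (f_{2t} - f_t * ψ_t) φ = O(t^{α/4})` and of `∫ f_t (S_t φ - φ)`. As `f_t` is of order
`t^{min A / 4}`, where `min A > -4`, the second term is summable over dyadic `t` once
`S_t φ - φ` is of order `t` up to a logarithm. This rate follows from the trivial rate `t^{1/4}` by
using the identity `S_t - 1 = (S_{2t} - 1) / 2 - (S_t - 1)² / 2` twice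
(`exists_weightedBound_heatIncr`), without any expansion of the kernel. Hence `∫ f_t φ` converges
along dyadic `t` to a distribution `R`. To estimate `R * ψ_T - f_T` one telescopes instead the
functions `f_t * ψ_{T-t}`, whose increments only contain the commutators.

For the uniqueness, the difference `u` of two reconstructions satisfies `u * ψ_T → 0` uniformly, and
`u(φ) = lim u(S_T φ) = lim ∫ (u * ψ_T) φ`. This identity, as well as `v_{s+t} = v_t * ψ_s`,
interchanges a distribution with an integral (`apply_schwartzConv`). Since the Schwartz space is not
normed, the distribution is extended by Hahn–Banach to a Banach space of weighted derivatives,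
where the Bochner integral is available.
-/

namespace Reconstruction

open MeasureTheory Filter Topology
open scoped BoundedContinuousFunction

/-! ### Weighted bounds and convolution of Schwartz functions -/

/-- The bound `(1 + ‖x‖)^k ‖D^n φ(x)‖ ≤ B` for all `x`. -/
def WeightedBound (k n : ℕ) (B : ℝ) (φ : 𝓢(Plane, ℝ)) : Prop :=
  ∀ x, (1 + ‖x‖) ^ k * ‖iteratedFDeriv ℝ n φ x‖ ≤ B

lemma weightedBound_seminorm (m k : ℕ × ℕ) (h1 : k.1 ≤ m.1) (h2 : k.2 ≤ m.2) (φ : 𝓢(Plane, ℝ)) :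
    WeightedBound k.1 k.2
      (2 ^ m.1 * (Finset.Iic m).sup (fun m => SchwartzMap.seminorm ℝ m.1 m.2) φ) φ :=
  fun x => SchwartzMap.one_add_le_sup_seminorm_apply h1 h2 φ x

lemma exists_weightedBound (k n : ℕ) (φ : 𝓢(Plane, ℝ)) : ∃ B, WeightedBound k n B φ :=
  ⟨_, weightedBound_seminorm (k, n) (k, n) le_rfl le_rfl φ⟩

namespace WeightedBound

variable {k n : ℕ} {B B' : ℝ} {φ χ : 𝓢(Plane, ℝ)}

lemma nonneg (h : WeightedBound k n B φ) : 0 ≤ B := le_trans (by positivity) (h 0)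

lemma mono (h : WeightedBound k n B φ) (hB : B ≤ B') : WeightedBound k n B' φ :=
  fun x => (h x).trans hB

lemma add (h : WeightedBound k n B φ) (h' : WeightedBound k n B' χ) :
    WeightedBound k n (B + B') (φ + χ) := by
  intro x
  have : iteratedFDeriv ℝ n (φ + χ : 𝓢(Plane, ℝ)) x =
      iteratedFDeriv ℝ n φ x + iteratedFDeriv ℝ n χ x :=
    iteratedFDeriv_add_apply ((φ.smooth n).contDiffAt) ((χ.smooth n).contDiffAt)
  rw [this]
  calc _ ≤ (1 + ‖x‖) ^ k * (‖iteratedFDeriv ℝ n φ x‖ + ‖iteratedFDeriv ℝ n χ x‖) := by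
        gcongr; exact norm_add_le _ _
    _ ≤ _ := by rw [mul_add]; exact add_le_add (h x) (h' x)

lemma smul (h : WeightedBound k n B φ) (c : ℝ) : WeightedBound k n (|c| * B) (c • φ) := by
  intro x
  have : iteratedFDeriv ℝ n (c • φ : 𝓢(Plane, ℝ)) x = c • iteratedFDeriv ℝ n φ x :=
    iteratedFDeriv_const_smul_apply ((φ.smooth n).contDiffAt)
  rw [this, norm_smul, Real.norm_eq_abs]
  calc _ = |c| * ((1 + ‖x‖) ^ k * ‖iteratedFDeriv ℝ n φ x‖) := by ring
    _ ≤ _ := by gcongr; exact h x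

lemma norm_le (h : WeightedBound k n B φ) (x : Plane) : ‖iteratedFDeriv ℝ n φ x‖ ≤ B := by
  refine le_trans ?_ (h x)
  exact le_mul_of_one_le_left (norm_nonneg _) (one_le_pow₀ (by simp))

end WeightedBound

lemma one_add_norm_pow_le (k : ℕ) (x h : Plane) :
    (1 + ‖x‖) ^ k ≤ (1 + ‖h‖) ^ k * (1 + ‖x - h‖) ^ k := by
  rw [← mul_pow]
  gcongr
  have : ‖x‖ ≤ ‖h‖ + ‖x - h‖ := by simpa using norm_add_le h (x - h)
  nlinarith [norm_nonneg h, norm_nonneg (x - h)]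

lemma iteratedFDeriv_bounded (φ : 𝓢(Plane, ℝ)) (n : ℕ) :
    ∃ B, ∀ x, ‖iteratedFDeriv ℝ n φ x‖ ≤ B :=
  let ⟨B, hB⟩ := exists_weightedBound 0 n φ
  ⟨B, hB.norm_le⟩

lemma continuous_iteratedFDeriv (φ : 𝓢(Plane, ℝ)) (n : ℕ) : Continuous (iteratedFDeriv ℝ n φ) :=
  (φ.smooth ⊤).continuous_iteratedFDeriv (mod_cast le_top)

lemma differentiable_iteratedFDeriv (φ : 𝓢(Plane, ℝ)) (n : ℕ) :
    Differentiable ℝ (iteratedFDeriv ℝ n φ) :=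
  (φ.smooth ⊤).differentiable_iteratedFDeriv (mod_cast ENat.natCast_lt_top n)

lemma integrable_smul_comp_sub {G : Type*} [NormedAddCommGroup G] [NormedSpace ℝ G]
    (g : 𝓢(Plane, ℝ)) {Φ : Plane → G} (hΦ : Continuous Φ) {B : ℝ} (hB : ∀ x, ‖Φ x‖ ≤ B)
    (x : Plane) : Integrable (fun h => g h • Φ (x - h)) := by
  refine (g.integrable.norm.mul_const B).mono'
    (g.continuous.smul (hΦ.comp (continuous_const.sub continuous_id))).aestronglyMeasurable
    (.of_forall fun h => ?_)
  rw [norm_smul]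
  gcongr
  exact hB _

lemma hasFDerivAt_integral_smul_comp_sub {G : Type*} [NormedAddCommGroup G] [NormedSpace ℝ G]
    (g : 𝓢(Plane, ℝ)) {Φ : Plane → G} (hΦ : Differentiable ℝ Φ) (hΦ' : Continuous (fderiv ℝ Φ))
    {B B' : ℝ} (hB : ∀ x, ‖Φ x‖ ≤ B) (hB' : ∀ x, ‖fderiv ℝ Φ x‖ ≤ B') (x : Plane) :
    HasFDerivAt (fun x => ∫ h, g h • Φ (x - h)) (∫ h, g h • fderiv ℝ Φ (x - h)) x := by
  refine hasFDerivAt_integral_of_dominated_of_fderiv_le (s := Set.univ)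
    (F := fun x h => g h • Φ (x - h)) (F' := fun x h => g h • fderiv ℝ Φ (x - h))
    (bound := fun h => ‖g h‖ * B')
    univ_mem ?_ ?_ ?_ ?_ ?_ ?_
  · exact .of_forall fun y => (integrable_smul_comp_sub g hΦ.continuous hB y).aestronglyMeasurable
  · exact integrable_smul_comp_sub g hΦ.continuous hB x
  · exact (integrable_smul_comp_sub g hΦ' hB' x).aestronglyMeasurable
  · refine .of_forall fun h y _ => ?_
    rw [norm_smul]
    gcongr
    exact hB' _
  · exact g.integrable.norm.mul_const _
  · refine .of_forall fun h y _ => ?_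
    have h1 : HasFDerivAt (fun z => Φ (z - h)) (fderiv ℝ Φ (y - h)) y := by
      exact (hasFDerivAt_comp_sub h).2 (hΦ (y - h)).hasFDerivAt
    exact h1.const_smul (g h)

lemma norm_fderiv_iteratedFDeriv_eq (φ : Plane → ℝ) (n : ℕ) (x : Plane) :
    ‖fderiv ℝ (iteratedFDeriv ℝ n φ) x‖ = ‖iteratedFDeriv ℝ (n + 1) φ x‖ :=
  norm_fderiv_iteratedFDeriv

lemma continuous_fderiv_iteratedFDeriv (φ : 𝓢(Plane, ℝ)) (n : ℕ) :
    Continuous (fderiv ℝ (iteratedFDeriv ℝ n φ)) := by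
  have h := continuous_iteratedFDeriv φ (n + 1)
  rw [iteratedFDeriv_succ_eq_comp_left] at h
  exact (LinearIsometryEquiv.comp_continuous_iff _).1 h

lemma hasFDerivAt_integral_smul_iteratedFDeriv (g φ : 𝓢(Plane, ℝ)) (n : ℕ) (x : Plane) :
    HasFDerivAt (fun x => ∫ h, g h • iteratedFDeriv ℝ n φ (x - h))
      (∫ h, g h • fderiv ℝ (iteratedFDeriv ℝ n φ) (x - h)) x := by
  obtain ⟨B, hB⟩ := iteratedFDeriv_bounded φ n
  obtain ⟨B', hB'⟩ := iteratedFDeriv_bounded φ (n + 1)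
  exact hasFDerivAt_integral_smul_comp_sub g (differentiable_iteratedFDeriv φ n)
    (continuous_fderiv_iteratedFDeriv φ n) hB
    (fun x => by rw [norm_fderiv_iteratedFDeriv_eq]; exact hB' x) x

/-- Derivatives of a convolution fall on the second factor. -/
lemma iteratedFDeriv_integral_mul (g φ : 𝓢(Plane, ℝ)) (n : ℕ) :
    iteratedFDeriv ℝ n (fun x => ∫ h, g h * φ (x - h)) =
      fun x => ∫ h, g h • iteratedFDeriv ℝ n φ (x - h) := by
  induction n with
  | zero =>
    ext x m
    have : (fun h => g h • iteratedFDeriv ℝ 0 φ (x - h)) = fun h =>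
        (continuousMultilinearCurryFin0 ℝ Plane ℝ).symm (g h * φ (x - h)) := by
      ext h m; simp
    rw [this]
    have h2 := (continuousMultilinearCurryFin0 ℝ Plane
      ℝ).symm.toContinuousLinearEquiv.integral_comp_comm (fun h => g h * φ (x - h)) (μ := volume)
    simp only [LinearIsometryEquiv.coe_toContinuousLinearEquiv] at h2
    rw [h2]
    simp
  | succ n ih =>
    rw [iteratedFDeriv_succ_eq_comp_left, ih]
    funext x
    simp only [Function.comp_apply]
    rw [(hasFDerivAt_integral_smul_iteratedFDeriv g φ n x).fderiv]
    have h2 := ContinuousLinearEquiv.integral_comp_comm (𝕜 := ℝ) (μ := volume)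
      (E := Plane →L[ℝ] Plane [×n]→L[ℝ] ℝ) (F := Plane [×(n + 1)]→L[ℝ] ℝ)
      (continuousMultilinearCurryLeftEquiv ℝ
        (fun _ : Fin (n + 1) => Plane) ℝ).symm.toContinuousLinearEquiv
      (fun h => g h • fderiv ℝ (iteratedFDeriv ℝ n φ) (x - h))
    simp only [LinearIsometryEquiv.coe_toContinuousLinearEquiv] at h2
    rw [← h2]
    congr 1

lemma integrable_norm_mul_one_add_pow (g : 𝓢(Plane, ℝ)) (k : ℕ) :
    Integrable (fun h => |g h| * (1 + ‖h‖) ^ k) := by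
  have : (fun h => |g h| * (1 + ‖h‖) ^ k) =
      fun h => ∑ i ∈ Finset.range (k + 1), (k.choose i : ℝ) * (‖h‖ ^ i * ‖g h‖) := by
    funext h
    rw [add_comm, add_pow, Finset.mul_sum]
    refine Finset.sum_congr rfl fun i _ => ?_
    rw [Real.norm_eq_abs]; ring
  rw [this]
  exact integrable_finsetSum _ fun i _ => (g.integrable_pow_mul volume i).const_mul _

lemma weighted_norm_integral_le {G : Type*} [NormedAddCommGroup G] [NormedSpace ℝ G]
    (g : 𝓢(Plane, ℝ)) {Φ : Plane → G} {k : ℕ} {B : ℝ}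
    (hB : ∀ x, (1 + ‖x‖) ^ k * ‖Φ x‖ ≤ B) (x : Plane) :
    (1 + ‖x‖) ^ k * ‖∫ h, g h • Φ (x - h)‖ ≤ (∫ h, |g h| * (1 + ‖h‖) ^ k) * B := by
  have hint : ∀ h, (1 + ‖x‖) ^ k * ‖g h • Φ (x - h)‖ ≤ |g h| * (1 + ‖h‖) ^ k * B := by
    intro h
    rw [norm_smul, Real.norm_eq_abs]
    calc _ ≤ ((1 + ‖h‖) ^ k * (1 + ‖x - h‖) ^ k) * (|g h| * ‖Φ (x - h)‖) := by
          gcongr; exact one_add_norm_pow_le k x h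
      _ = |g h| * (1 + ‖h‖) ^ k * ((1 + ‖x - h‖) ^ k * ‖Φ (x - h)‖) := by ring
      _ ≤ _ := by gcongr; exact hB _
  have hpos : 0 < (1 + ‖x‖) ^ k := by positivity
  rw [← integral_mul_const]
  calc _ = ‖∫ h, (1 + ‖x‖) ^ k • (g h • Φ (x - h))‖ := by
        rw [integral_smul, norm_smul, Real.norm_of_nonneg hpos.le]
    _ ≤ _ := by
        refine norm_integral_le_of_norm_le ((integrable_norm_mul_one_add_pow g k).mul_const B)
          (.of_forall fun h => ?_)
        rw [norm_smul, Real.norm_of_nonneg hpos.le]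
        exact hint h

/-- The convolution `(g * φ)(x) = ∫ g(h) φ(x - h) dh` of two real Schwartz functions. -/
noncomputable def schwartzConv (g φ : 𝓢(Plane, ℝ)) : 𝓢(Plane, ℝ) where
  toFun x := ∫ h, g h * φ (x - h)
  smooth' := by
    refine contDiff_of_differentiable_iteratedFDeriv fun m _ => ?_
    rw [iteratedFDeriv_integral_mul]
    exact fun x => (hasFDerivAt_integral_smul_iteratedFDeriv g φ m x).differentiableAt
  decay' := by
    intro k n
    obtain ⟨B, hB⟩ := exists_weightedBound k n φ
    refine ⟨(∫ h, |g h| * (1 + ‖h‖) ^ k) * B, fun x => ?_⟩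
    rw [iteratedFDeriv_integral_mul]
    refine le_trans ?_ (weighted_norm_integral_le g hB x)
    gcongr
    linarith

lemma schwartzConv_apply (g φ : 𝓢(Plane, ℝ)) (x : Plane) :
    schwartzConv g φ x = ∫ h, g h * φ (x - h) := rfl

lemma iteratedFDeriv_schwartzConv (g φ : 𝓢(Plane, ℝ)) (n : ℕ) (x : Plane) :
    iteratedFDeriv ℝ n (schwartzConv g φ) x = ∫ h, g h • iteratedFDeriv ℝ n φ (x - h) :=
  congrFun (iteratedFDeriv_integral_mul g φ n) x

lemma WeightedBound.conv_right {k n : ℕ} {B : ℝ} {φ : 𝓢(Plane, ℝ)} (h : WeightedBound k n B φ)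
    (g : 𝓢(Plane, ℝ)) :
    WeightedBound k n ((∫ h, |g h| * (1 + ‖h‖) ^ k) * B) (schwartzConv g φ) := by
  intro x
  rw [iteratedFDeriv_schwartzConv]
  exact weighted_norm_integral_le g h x

/-- Weighted first order Taylor estimate. -/
lemma WeightedBound.norm_translate_sub_le {k n : ℕ} {B : ℝ} {φ : 𝓢(Plane, ℝ)}
    (hφ : WeightedBound k (n + 1) B φ) (x h : Plane) :
    (1 + ‖x‖) ^ k * ‖iteratedFDeriv ℝ n φ (x - h) - iteratedFDeriv ℝ n φ x‖ ≤
      B * (‖h‖ * (1 + ‖h‖) ^ k) := by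
  have hpos : 0 < (1 + ‖x‖) ^ k := by positivity
  have key : ‖iteratedFDeriv ℝ n φ (x - h) - iteratedFDeriv ℝ n φ x‖ ≤
      B * (1 + ‖h‖) ^ k / (1 + ‖x‖) ^ k * ‖(x - h) - x‖ := by
    refine (convex_segment x (x - h)).norm_image_sub_le_of_norm_fderiv_le (𝕜 := ℝ)
      (fun z _ => differentiable_iteratedFDeriv φ n z) (fun z hz => ?_)
      (left_mem_segment ℝ _ _) (right_mem_segment ℝ _ _)
    rw [norm_fderiv_iteratedFDeriv_eq, le_div_iff₀ hpos]
    have hzx : ‖x - z‖ ≤ ‖h‖ := by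
      obtain ⟨a, b, ha, hb, hab, rfl⟩ := hz
      have : x - (a • x + b • (x - h)) = b • h := by
        have : a = 1 - b := by linarith
        rw [this]; module
      rw [this, norm_smul, Real.norm_of_nonneg hb]
      exact mul_le_of_le_one_left (norm_nonneg _) (by linarith)
    calc _ ≤ ‖iteratedFDeriv ℝ (n + 1) φ z‖ * ((1 + ‖h‖) ^ k * (1 + ‖z‖) ^ k) := by
          gcongr
          have := one_add_norm_pow_le k x (x - z)
          rw [sub_sub_cancel] at this
          refine this.trans ?_
          gcongr
      _ = (1 + ‖h‖) ^ k * ((1 + ‖z‖) ^ k * ‖iteratedFDeriv ℝ (n + 1) φ z‖) := by ring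
      _ ≤ (1 + ‖h‖) ^ k * B := by gcongr; exact hφ z
      _ = _ := by ring
  calc _ ≤ (1 + ‖x‖) ^ k * (B * (1 + ‖h‖) ^ k / (1 + ‖x‖) ^ k * ‖(x - h) - x‖) := by gcongr
    _ = _ := by
      rw [show x - h - x = -h by abel, norm_neg]
      field_simp

/-- Convolution with a kernel of unit mass moves a Schwartz function by at most the first moment of
the kernel, at the cost of one derivative. -/
lemma WeightedBound.schwartzConv_sub {k n : ℕ} {B : ℝ} {φ : 𝓢(Plane, ℝ)}
    (hφ : WeightedBound k (n + 1) B φ) (g : 𝓢(Plane, ℝ)) (hg : ∫ h, g h = 1) :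
    WeightedBound k n ((∫ h, |g h| * (‖h‖ * (1 + ‖h‖) ^ k)) * B) (schwartzConv g φ - φ) := by
  intro x
  obtain ⟨B', hB'⟩ := iteratedFDeriv_bounded φ n
  have h1 : iteratedFDeriv ℝ n (schwartzConv g φ - φ : 𝓢(Plane, ℝ)) x =
      ∫ h, g h • (iteratedFDeriv ℝ n φ (x - h) - iteratedFDeriv ℝ n φ x) := by
    have h2 : iteratedFDeriv ℝ n (schwartzConv g φ - φ : 𝓢(Plane, ℝ)) x =
        iteratedFDeriv ℝ n (schwartzConv g φ) x - iteratedFDeriv ℝ n φ x :=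
      iteratedFDeriv_sub_apply (((schwartzConv g φ).smooth n).contDiffAt)
        ((φ.smooth n).contDiffAt)
    rw [h2, iteratedFDeriv_schwartzConv]
    simp_rw [smul_sub]
    rw [integral_sub (integrable_smul_comp_sub g (continuous_iteratedFDeriv φ n) hB' x)
      (g.integrable.smul_const _), integral_smul_const, hg, one_smul]
  have hpos : 0 < (1 + ‖x‖) ^ k := by positivity
  have hmom : Integrable (fun h => |g h| * (‖h‖ * (1 + ‖h‖) ^ k)) := by
    refine (integrable_norm_mul_one_add_pow g (k + 1)).mono' (by fun_prop)
      (.of_forall fun h => ?_)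
    rw [Real.norm_of_nonneg (by positivity), pow_succ']
    gcongr
    linarith
  rw [h1, ← integral_mul_const]
  calc _ = ‖∫ h, (1 + ‖x‖) ^ k •
          (g h • (iteratedFDeriv ℝ n φ (x - h) - iteratedFDeriv ℝ n φ x))‖ := by
        rw [integral_smul, norm_smul, Real.norm_of_nonneg hpos.le]
    _ ≤ _ := by
        refine norm_integral_le_of_norm_le (hmom.mul_const B) (.of_forall fun h => ?_)
        rw [norm_smul, norm_smul, Real.norm_of_nonneg hpos.le, Real.norm_eq_abs]
        calc _ = |g h| * ((1 + ‖x‖) ^ k *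
              ‖iteratedFDeriv ℝ n φ (x - h) - iteratedFDeriv ℝ n φ x‖) := by ring
          _ ≤ |g h| * (B * (‖h‖ * (1 + ‖h‖) ^ k)) := by
              exact mul_le_mul_of_nonneg_left (hφ.norm_translate_sub_le x h) (abs_nonneg _)
          _ = _ := by ring

/-- The translate `z ↦ φ(z - h)`. -/
noncomputable abbrev translate (h : Plane) (φ : 𝓢(Plane, ℝ)) : 𝓢(Plane, ℝ) :=
  SchwartzMap.compSubConstCLM ℝ h φ

lemma iteratedFDeriv_translate (h : Plane) (φ : 𝓢(Plane, ℝ)) (n : ℕ) (x : Plane) :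
    iteratedFDeriv ℝ n (translate h φ) x = iteratedFDeriv ℝ n φ (x - h) :=
  iteratedFDeriv_comp_sub n h x

lemma WeightedBound.translate {k n : ℕ} {B : ℝ} {φ : 𝓢(Plane, ℝ)} (hφ : WeightedBound k n B φ)
    (h : Plane) : WeightedBound k n ((1 + ‖h‖) ^ k * B) (translate h φ) := by
  intro x
  rw [iteratedFDeriv_translate]
  calc _ ≤ ((1 + ‖h‖) ^ k * (1 + ‖x - h‖) ^ k) * ‖iteratedFDeriv ℝ n φ (x - h)‖ := by
        gcongr; exact one_add_norm_pow_le k x h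
    _ = (1 + ‖h‖) ^ k * ((1 + ‖x - h‖) ^ k * ‖iteratedFDeriv ℝ n φ (x - h)‖) := by ring
    _ ≤ _ := by gcongr; exact hφ _

/-- Translates depend continuously on the shift, in the Schwartz topology. -/
lemma continuous_translate (φ : 𝓢(Plane, ℝ)) : Continuous (fun h => translate h φ) := by
  rw [continuous_iff_continuousAt]
  intro a
  unfold ContinuousAt
  rw [(schwartz_withSeminorms ℝ Plane ℝ).tendsto_nhds _ _]
  rintro ⟨k, n⟩ ε hε
  obtain ⟨B, hB⟩ := exists_weightedBound k (n + 1) φ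
  have hB' := hB.translate a
  set C := (1 + ‖a‖) ^ k * B
  have hlim : Tendsto (fun h : Plane => C * (‖h - a‖ * (1 + ‖h - a‖) ^ k)) (𝓝 a) (𝓝 0) := by
    have : Continuous (fun h : Plane => C * (‖h - a‖ * (1 + ‖h - a‖) ^ k)) := by fun_prop
    simpa using this.tendsto a
  filter_upwards [hlim.eventually_lt_const hε] with h hh
  refine lt_of_le_of_lt ?_ hh
  refine SchwartzMap.seminorm_le_bound ℝ k n _ (mul_nonneg hB'.nonneg (by positivity)) fun x => ?_
  have h2 : iteratedFDeriv ℝ n (translate h φ - translate a φ : 𝓢(Plane, ℝ)) x =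
      iteratedFDeriv ℝ n (translate a φ) (x - (h - a)) -
        iteratedFDeriv ℝ n (translate a φ) x := by
    rw [iteratedFDeriv_translate, iteratedFDeriv_translate,
      show x - (h - a) - a = x - h by abel, ← iteratedFDeriv_translate h,
      ← iteratedFDeriv_translate a]
    exact iteratedFDeriv_sub_apply (((translate h φ).smooth n).contDiffAt)
        (((translate a φ).smooth n).contDiffAt)
  rw [h2]
  refine le_trans ?_ (hB'.norm_translate_sub_le x (h - a))
  gcongr
  linarith

/-! ### The heat kernel -/

lemma semigroupSymbol_apply {T : ℝ} (hT : 0 < T) (ξ : Plane) :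
    semigroupSymbol T ξ = Real.exp (-symbolExponent T ξ) := by
  simp only [semigroupSymbol, dif_pos hT]
  rfl

lemma symbolExponent_neg (T : ℝ) (ξ : Plane) : symbolExponent T (-ξ) = symbolExponent T ξ := by
  simp only [symbolExponent, PiLp.neg_apply]; ring

lemma semigroupSymbol_neg (T : ℝ) (ξ : Plane) : semigroupSymbol T (-ξ) = semigroupSymbol T ξ := by
  by_cases hT : 0 < T
  · rw [semigroupSymbol_apply hT, semigroupSymbol_apply hT, symbolExponent_neg]
  · simp [semigroupSymbol, hT]

/-- The symbol of the semigroup with complex values. -/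
noncomputable def complexSymbol (T : ℝ) : 𝓢(Plane, ℂ) :=
  SchwartzMap.postcompCLM Complex.ofRealCLM (semigroupSymbol T)

/-- The heat kernel with complex values. -/
noncomputable def complexHeatKernel (T : ℝ) : 𝓢(Plane, ℂ) := 𝓕⁻ (complexSymbol T)

lemma complexSymbol_apply (T : ℝ) (ξ : Plane) : complexSymbol T ξ = (semigroupSymbol T ξ : ℂ) := rfl

lemma complexHeatKernel_apply (T : ℝ) (x : Plane) :
    complexHeatKernel T x = ∫ ξ : Plane,
      Complex.exp (↑(2 * Real.pi * inner ℝ ξ x) * Complex.I) * (semigroupSymbol T ξ : ℂ) := by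
  rw [complexHeatKernel, SchwartzMap.fourierInv_coe, Real.fourierInv_eq']
  rfl

lemma complexHeatKernel_neg (T : ℝ) (x : Plane) :
    complexHeatKernel T (-x) = complexHeatKernel T x := by
  rw [complexHeatKernel_apply, complexHeatKernel_apply, ← integral_neg_eq_self]
  simp [semigroupSymbol_neg]

/-- The inverse Fourier transform of the symbol is real, as the symbol is real and even. -/
lemma ofReal_heatKernel (T : ℝ) (x : Plane) : (heatKernel T x : ℂ) = complexHeatKernel T x := by
  have h : (starRingEnd ℂ) (complexHeatKernel T x) = complexHeatKernel T x := by
    conv_rhs => rw [← complexHeatKernel_neg]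
    rw [complexHeatKernel_apply, complexHeatKernel_apply, ← integral_conj]
    congr 1
    funext ξ
    rw [map_mul, ← Complex.exp_conj, map_mul, Complex.conj_I, Complex.conj_ofReal,
      Complex.conj_ofReal, inner_neg_right]
    push_cast
    ring_nf
  exact Complex.conj_eq_iff_re.1 h

lemma heatKernel_neg (T : ℝ) (x : Plane) : heatKernel T (-x) = heatKernel T x := by
  have := complexHeatKernel_neg T x
  rw [← ofReal_heatKernel, ← ofReal_heatKernel] at this
  exact_mod_cast this

lemma heatKernelAt_eq_translate (T : ℝ) (x : Plane) :
    heatKernelAt T x = translate x (heatKernel T) := by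
  ext y
  rw [heatKernelAt_apply, SchwartzMap.compSubConstCLM_apply, ← heatKernel_neg, neg_sub]

lemma integral_heatKernel {T : ℝ} (hT : 0 < T) : ∫ h, heatKernel T h = 1 := by
  have h : 𝓕 (complexHeatKernel T) 0 = 1 := by
    rw [complexHeatKernel, FourierTransform.fourier_fourierInv_eq, complexSymbol_apply,
      semigroupSymbol_apply hT]
    simp [symbolExponent]
  rw [SchwartzMap.fourier_coe, Real.fourier_eq'] at h
  simp only [inner_zero_right, mul_zero, Complex.ofReal_zero, zero_mul, Complex.exp_zero,
    one_smul] at h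
  simp_rw [← ofReal_heatKernel] at h
  exact Complex.ofReal_injective
    ((integral_ofReal (𝕜 := ℂ) (f := heatKernel T) (μ := volume)).symm.trans h)

/-- The semigroup property `ψ_s * ψ_t = ψ_{s+t}`. -/
lemma schwartzConv_heatKernel {s t : ℝ} (hs : 0 < s) (ht : 0 < t) :
    schwartzConv (heatKernel s) (heatKernel t) = heatKernel (s + t) := by
  have h : SchwartzMap.convolution (ContinuousLinearMap.mul ℂ ℂ) (complexHeatKernel s)
      (complexHeatKernel t) = complexHeatKernel (s + t) := by
    have h1 : 𝓕 (SchwartzMap.convolution (ContinuousLinearMap.mul ℂ ℂ) (complexHeatKernel s)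
        (complexHeatKernel t)) = complexSymbol (s + t) := by
      rw [SchwartzMap.fourier_convolution]
      simp only [complexHeatKernel, FourierTransform.fourier_fourierInv_eq]
      ext ξ
      rw [SchwartzMap.pairing_apply_apply, complexSymbol_apply, complexSymbol_apply,
        complexSymbol_apply, semigroupSymbol_apply hs, semigroupSymbol_apply ht,
        semigroupSymbol_apply (add_pos hs ht), ContinuousLinearMap.mul_apply',
        ← Complex.ofReal_mul, ← Real.exp_add]
      congr 2
      simp only [symbolExponent]
      ring
    conv_rhs => rw [complexHeatKernel, ← h1, FourierTransform.fourierInv_fourier_eq]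
  ext x
  have h2 := SchwartzMap.convolution_apply (ContinuousLinearMap.mul ℂ ℂ) (complexHeatKernel s)
      (complexHeatKernel t) x
  rw [h, ← ofReal_heatKernel, convolution_def] at h2
  simp only [← ofReal_heatKernel, ContinuousLinearMap.mul_apply', ← Complex.ofReal_mul] at h2
  rw [schwartzConv_apply]
  have h3 := integral_ofReal (𝕜 := ℂ) (f := fun h => heatKernel s h * heatKernel t (x - h))
    (μ := volume)
  exact Complex.ofReal_injective (h2.trans h3).symm

/-- The parabolic dilation `(x₁, x₂) ↦ (r x₁, r² x₂)`. -/
noncomputable def parabolicScale (r : ℝ) (hr : r ≠ 0) : Plane ≃ₗ[ℝ] Plane where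
  toFun x := !₂[r * x 0, r ^ 2 * x 1]
  invFun x := !₂[r⁻¹ * x 0, (r ^ 2)⁻¹ * x 1]
  map_add' x y := by ext i; fin_cases i <;> simp [mul_add]
  map_smul' c x := by ext i; fin_cases i <;> simp <;> ring
  left_inv x := by ext i; fin_cases i <;> simp [hr]
  right_inv x := by ext i; fin_cases i <;> simp [hr]

@[simp] lemma parabolicScale_zero (r : ℝ) (hr : r ≠ 0) (x : Plane) :
    parabolicScale r hr x 0 = r * x 0 := rfl

@[simp] lemma parabolicScale_one (r : ℝ) (hr : r ≠ 0) (x : Plane) :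
    parabolicScale r hr x 1 = r ^ 2 * x 1 := rfl

lemma integral_comp_linearEquiv {G : Type*} [NormedAddCommGroup G] [NormedSpace ℝ G]
    (e : Plane ≃ₗ[ℝ] Plane) (F : Plane → G) :
    ∫ x, F (e x) = |(LinearMap.det (e : Plane →ₗ[ℝ] Plane))⁻¹| • ∫ x, F x := by
  have hdet : LinearMap.det (e : Plane →ₗ[ℝ] Plane) ≠ 0 := e.isUnit_det'.ne_zero
  have hmap := Measure.map_linearMap_addHaar_eq_smul_addHaar (volume : Measure Plane) hdet
  have h1 : ∫ x, F x ∂(Measure.map e volume) = ∫ x, F (e x) :=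
    e.toContinuousLinearEquiv.toHomeomorph.measurableEmbedding.integral_map F
  have h2 : Measure.map e volume = Measure.map (e : Plane →ₗ[ℝ] Plane) volume := rfl
  rw [← h1, h2, hmap, integral_smul_measure, ENNReal.toReal_ofReal (abs_nonneg _)]

lemma symbolExponent_pow_four (r : ℝ) (hr : r ≠ 0) (ξ : Plane) :
    symbolExponent (r ^ 4) ξ = symbolExponent 1 (parabolicScale r hr ξ) := by
  simp [symbolExponent]; ring

lemma inner_parabolicScale (r : ℝ) (hr : r ≠ 0) (x y : Plane) :
    inner ℝ x (parabolicScale r hr y) = inner ℝ (parabolicScale r hr x) y := by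
  simp [PiLp.inner_apply, Fin.sum_univ_two]; ring

/-- Parabolic scaling of the heat kernel. -/
lemma heatKernel_parabolicScale {r : ℝ} (hr : 0 < r) (x : Plane) :
    heatKernel (r ^ 4) (parabolicScale r hr.ne' x) =
      |(LinearMap.det (parabolicScale r hr.ne' : Plane →ₗ[ℝ] Plane))⁻¹| * heatKernel 1 x := by
  have h4 : 0 < r ^ 4 := by positivity
  have h : complexHeatKernel (r ^ 4) (parabolicScale r hr.ne' x) =
      |(LinearMap.det (parabolicScale r hr.ne' : Plane →ₗ[ℝ] Plane))⁻¹| •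
        complexHeatKernel 1 x := by
    rw [complexHeatKernel_apply, complexHeatKernel_apply, ← integral_comp_linearEquiv]
    congr 1
    funext ξ
    rw [inner_parabolicScale, semigroupSymbol_apply h4, semigroupSymbol_apply one_pos,
      symbolExponent_pow_four r hr.ne']
  rw [← ofReal_heatKernel, ← ofReal_heatKernel, Complex.real_smul] at h
  exact_mod_cast h

/-- Integrals against `|ψ_T|` reduce to integrals against `|ψ_1|` by parabolic scaling. -/
lemma integral_abs_heatKernel_mul {r : ℝ} (hr : 0 < r) (G : Plane → ℝ) :
    ∫ h, |heatKernel (r ^ 4) h| * G h =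
      ∫ z, |heatKernel 1 z| * G (parabolicScale r hr.ne' z) := by
  have h1 := integral_comp_linearEquiv (parabolicScale r hr.ne')
    (fun h => |heatKernel (r ^ 4) h| * G h)
  set c := |(LinearMap.det (parabolicScale r hr.ne' : Plane →ₗ[ℝ] Plane))⁻¹| with hc
  have hc0 : 0 < c := abs_pos.2 (inv_ne_zero (parabolicScale r hr.ne').isUnit_det'.ne_zero)
  simp only [heatKernel_parabolicScale hr, ← hc, abs_mul, abs_of_pos hc0, mul_assoc] at h1
  rw [integral_const_mul, smul_eq_mul] at h1
  exact (mul_left_cancel₀ hc0.ne' h1).symm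

lemma integrable_abs_mul (g : 𝓢(Plane, ℝ)) {G : Plane → ℝ} (hG : Continuous G) {C : ℝ} {k : ℕ}
    (hC : ∀ h, |G h| ≤ C * (1 + ‖h‖) ^ k) : Integrable (fun h => |g h| * G h) := by
  refine ((integrable_norm_mul_one_add_pow g k).const_mul C).mono' (by fun_prop)
    (.of_forall fun h => ?_)
  rw [norm_mul, Real.norm_eq_abs, Real.norm_eq_abs, abs_abs]
  calc _ ≤ |g h| * (C * (1 + ‖h‖) ^ k) := by gcongr; exact hC h
    _ = _ := by ring

lemma schwartzConv_translate (g φ : 𝓢(Plane, ℝ)) (x : Plane) :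
    schwartzConv g (translate x φ) = translate x (schwartzConv g φ) := by
  ext y
  simp only [schwartzConv_apply, SchwartzMap.compSubConstCLM_apply]
  congr 1
  funext h
  rw [sub_right_comm]

lemma schwartzConv_heatKernelAt {s t : ℝ} (hs : 0 < s) (ht : 0 < t) (x : Plane) :
    schwartzConv (heatKernel s) (heatKernelAt t x) = heatKernelAt (s + t) x := by
  rw [heatKernelAt_eq_translate, heatKernelAt_eq_translate, schwartzConv_translate,
    schwartzConv_heatKernel hs ht]

lemma schwartzConv_sub_right (g φ χ : 𝓢(Plane, ℝ)) :
    schwartzConv g (φ - χ) = schwartzConv g φ - schwartzConv g χ := by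
  ext x
  have h (φ : 𝓢(Plane, ℝ)) : Integrable (fun h => g h * φ (x - h)) := by
    obtain ⟨B, hB⟩ := exists_weightedBound 0 0 φ
    exact integrable_smul_comp_sub g φ.continuous (fun x => by simpa using hB.norm_le x) x
  simp only [schwartzConv_apply, sub_apply, mul_sub]
  exact integral_sub (h φ) (h χ)

lemma schwartzConv_comm (g φ : 𝓢(Plane, ℝ)) : schwartzConv g φ = schwartzConv φ g := by
  ext x
  rw [schwartzConv_apply, schwartzConv_apply, ← integral_sub_left_eq_self _ _ x]
  simp [mul_comm]

/-! ### Tempered distributions and convolution -/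

/-- The bounded continuous function `x ↦ ‖x‖^k D^n φ(x)`, whose sup norm is the Schwartz seminorm
with the indices `k` and `n`. -/
noncomputable def weightedDeriv (k n : ℕ) : 𝓢(Plane, ℝ) →ₗ[ℝ] (Plane →ᵇ (Plane [×n]→L[ℝ] ℝ)) where
  toFun φ := BoundedContinuousFunction.ofNormedAddCommGroup
    (fun x => ‖x‖ ^ k • iteratedFDeriv ℝ n φ x)
    ((continuous_norm.pow k).smul (continuous_iteratedFDeriv φ n)) (SchwartzMap.seminorm ℝ k n φ)
    (fun x => by
      rw [norm_smul, norm_pow, norm_norm]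
      exact SchwartzMap.le_seminorm ℝ k n φ x)
  map_add' φ χ := by
    ext1 x
    have : iteratedFDeriv ℝ n (φ + χ : 𝓢(Plane, ℝ)) x =
        iteratedFDeriv ℝ n φ x + iteratedFDeriv ℝ n χ x :=
      iteratedFDeriv_add_apply ((φ.smooth n).contDiffAt) ((χ.smooth n).contDiffAt)
    change ‖x‖ ^ k • iteratedFDeriv ℝ n (φ + χ : 𝓢(Plane, ℝ)) x =
      ‖x‖ ^ k • iteratedFDeriv ℝ n φ x + ‖x‖ ^ k • iteratedFDeriv ℝ n χ x
    rw [this, smul_add]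
  map_smul' c φ := by
    ext1 x
    have : iteratedFDeriv ℝ n (c • φ : 𝓢(Plane, ℝ)) x = c • iteratedFDeriv ℝ n φ x :=
      iteratedFDeriv_const_smul_apply ((φ.smooth n).contDiffAt)
    change ‖x‖ ^ k • iteratedFDeriv ℝ n (c • φ : 𝓢(Plane, ℝ)) x =
      c • ‖x‖ ^ k • iteratedFDeriv ℝ n φ x
    rw [this, smul_comm]

lemma weightedDeriv_apply (k n : ℕ) (φ : 𝓢(Plane, ℝ)) (x : Plane) :
    weightedDeriv k n φ x = ‖x‖ ^ k • iteratedFDeriv ℝ n φ x := rfl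

lemma norm_weightedDeriv (k n : ℕ) (φ : 𝓢(Plane, ℝ)) :
    ‖weightedDeriv k n φ‖ = SchwartzMap.seminorm ℝ k n φ := by
  have h0 : 0 ≤ ‖weightedDeriv k n φ‖ := norm_nonneg (weightedDeriv k n φ)
  refine le_antisymm ?_ ?_
  · refine ((weightedDeriv k n φ).norm_le (apply_nonneg _ _)).2 fun x => ?_
    rw [weightedDeriv_apply, norm_smul, norm_pow, norm_norm]
    exact SchwartzMap.le_seminorm ℝ k n φ x
  · refine SchwartzMap.seminorm_le_bound ℝ k n φ h0 fun x => ?_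
    refine le_trans (le_of_eq ?_) ((weightedDeriv k n φ).norm_coe_le_norm x)
    rw [weightedDeriv_apply, norm_smul, norm_pow, norm_norm]

/-- The finite products of the spaces of bounded continuous functions in which the weighted
derivatives with indices in `s` live. It is a definition, with its own normed structure, in order to
hide the multilinear maps from the type class inference. -/
def JetSpace (s : Finset (ℕ × ℕ)) : Type :=
  ∀ i : s, Plane →ᵇ (Plane [×i.1.2]→L[ℝ] ℝ)

noncomputable instance (s : Finset (ℕ × ℕ)) : NormedAddCommGroup (JetSpace s) :=
  inferInstanceAs (NormedAddCommGroup (∀ i : s, Plane →ᵇ (Plane [×i.1.2]→L[ℝ] ℝ)))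

noncomputable instance (s : Finset (ℕ × ℕ)) : NormedSpace ℝ (JetSpace s) :=
  inferInstanceAs (NormedSpace ℝ (∀ i : s, Plane →ᵇ (Plane [×i.1.2]→L[ℝ] ℝ)))

instance (s : Finset (ℕ × ℕ)) : CompleteSpace (JetSpace s) :=
  inferInstanceAs (CompleteSpace (∀ i : s, Plane →ᵇ (Plane [×i.1.2]→L[ℝ] ℝ)))

lemma JetSpace.norm_apply_le {s : Finset (ℕ × ℕ)} (f : JetSpace s) (i : s) : ‖f i‖ ≤ ‖f‖ :=
  norm_le_pi_norm (G := fun i : s => Plane →ᵇ (Plane [×i.1.2]→L[ℝ] ℝ)) f i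

lemma JetSpace.norm_le {s : Finset (ℕ × ℕ)} (f : JetSpace s) {C : ℝ} (hC : 0 ≤ C)
    (h : ∀ i, ‖f i‖ ≤ C) : ‖f‖ ≤ C :=
  (pi_norm_le_iff_of_nonneg (G := fun i : s => Plane →ᵇ (Plane [×i.1.2]→L[ℝ] ℝ)) hC).2 h

/-- The value of the `i`-th component of a jet at the point `x` and the vectors `m`. -/
noncomputable def JetSpace.eval {s : Finset (ℕ × ℕ)} (i : s) (x : Plane) (m : Fin i.1.2 → Plane) :
    JetSpace s →L[ℝ] ℝ :=
  LinearMap.mkContinuous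
    { toFun := fun f => f i x m
      map_add' := fun _ _ => rfl
      map_smul' := fun _ _ => rfl } (∏ j, ‖m j‖) fun f => by
    refine ((f i x).le_opNorm m).trans ?_
    rw [mul_comm]
    gcongr
    exact ((f i).norm_coe_le_norm x).trans (f.norm_apply_le i)

/-- The map sending a Schwartz function to its weighted derivatives with indices in `s`. -/
noncomputable def jet (s : Finset (ℕ × ℕ)) : 𝓢(Plane, ℝ) →ₗ[ℝ] JetSpace s where
  toFun φ i := weightedDeriv i.1.1 i.1.2 φ
  map_add' φ χ := funext fun i => map_add (weightedDeriv i.1.1 i.1.2) φ χ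
  map_smul' c φ := funext fun i => map_smul (weightedDeriv i.1.1 i.1.2) c φ

lemma norm_jet_apply (s : Finset (ℕ × ℕ)) (φ : 𝓢(Plane, ℝ)) (i : s) :
    ‖jet s φ i‖ = SchwartzMap.seminorm ℝ i.1.1 i.1.2 φ := norm_weightedDeriv _ _ _

lemma norm_jet (s : Finset (ℕ × ℕ)) (φ : 𝓢(Plane, ℝ)) :
    ‖jet s φ‖ = s.sup (schwartzSeminormFamily ℝ Plane ℝ) φ := by
  refine le_antisymm ((jet s φ).norm_le (apply_nonneg _ _) fun i => ?_) ?_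
  · rw [norm_jet_apply]
    exact Seminorm.le_finset_sup_apply (p := schwartzSeminormFamily ℝ Plane ℝ) i.2
  · refine Seminorm.finset_sup_apply_le (norm_nonneg _) fun i hi => ?_
    exact (norm_jet_apply s φ ⟨i, hi⟩).symm.le.trans ((jet s φ).norm_apply_le ⟨i, hi⟩)

lemma continuous_jet (s : Finset (ℕ × ℕ)) : Continuous (jet s) := by
  refine WithSeminorms.continuous_normedSpace_rng _ (schwartz_withSeminorms ℝ Plane ℝ)
    (jet s) ⟨s, 1, fun φ => ?_⟩
  rw [one_smul]
  exact (norm_jet s φ).le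

/-- A tempered distribution is bounded by finitely many Schwartz seminorms, hence by Hahn–Banach it
extends to a bounded functional on a space of jets. -/
lemma exists_extension_jet (u : TemperedDist ℝ) :
    ∃ (s : Finset (ℕ × ℕ)) (w : JetSpace s →L[ℝ] ℝ), ∀ φ, w (jet s φ) = u φ := by
  obtain ⟨s, C, -, hC⟩ := Seminorm.bound_of_continuous (schwartz_withSeminorms ℝ Plane ℝ)
    ((normSeminorm ℝ ℝ).comp u.toLinearMap) (by
      change Continuous fun φ => ‖u φ‖
      fun_prop)
  have hC' : ∀ φ, ‖u φ‖ ≤ C * ‖jet s φ‖ := fun φ => by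
    rw [norm_jet]
    exact hC φ
  obtain ⟨σ, hσ⟩ := (jet s).rangeRestrict.exists_rightInverse_of_surjective
    (LinearMap.range_rangeRestrict _)
  have hσ' : ∀ y, jet s (σ y) = y := fun y => congrArg Subtype.val (LinearMap.congr_fun hσ y)
  let f : StrongDual ℝ (LinearMap.range (jet s)) :=
    LinearMap.mkContinuous (u.toLinearMap ∘ₗ σ) C fun y => by
      have := hC' (σ y)
      rwa [hσ'] at this
  obtain ⟨w, hw, -⟩ := exists_extension_norm_eq (𝕜 := ℝ) (LinearMap.range (jet s)) f
  refine ⟨s, w, fun φ => ?_⟩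
  have h1 := hw ⟨jet s φ, LinearMap.mem_range_self _ _⟩
  have h2 : u (σ ⟨jet s φ, LinearMap.mem_range_self _ _⟩ - φ) = 0 := by
    rw [← norm_le_zero_iff]
    refine (hC' _).trans (le_of_eq ?_)
    rw [map_sub, hσ', sub_self, norm_zero, mul_zero]
  rw [map_sub, sub_eq_zero] at h2
  rw [← h2]
  exact h1

lemma norm_jet_translate_le (s : Finset (ℕ × ℕ)) (φ : 𝓢(Plane, ℝ)) :
    ∃ (C : ℝ) (k : ℕ), ∀ h, ‖jet s (translate h φ)‖ ≤ C * (1 + ‖h‖) ^ k := by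
  choose B hB using fun i : ℕ × ℕ => exists_weightedBound i.1 i.2 φ
  have hB0 := fun i => (hB i).nonneg
  refine ⟨∑ i ∈ s, B i, s.sup Prod.fst, fun h => ?_⟩
  have hS : 0 ≤ ∑ i ∈ s, B i := Finset.sum_nonneg fun i _ => hB0 i
  refine JetSpace.norm_le _ (by positivity) fun i => ?_
  rw [norm_jet_apply]
  refine SchwartzMap.seminorm_le_bound ℝ _ _ _ (by positivity) fun x => ?_
  calc _ ≤ (1 + ‖x‖) ^ i.1.1 * ‖iteratedFDeriv ℝ i.1.2 (translate h φ) x‖ := by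
        gcongr; linarith
    _ ≤ (1 + ‖h‖) ^ i.1.1 * B i.1 := (hB i.1).translate h x
    _ ≤ (1 + ‖h‖) ^ (s.sup Prod.fst) * ∑ i ∈ s, B i := by
        gcongr
        · exact hB0 _
        · linarith [norm_nonneg h]
        · exact Finset.le_sup (f := Prod.fst) i.2
        · exact Finset.single_le_sum (f := B) (fun j _ => hB0 j) i.2
    _ = _ := mul_comm _ _

lemma continuous_apply_translate {F : Type*} [NormedAddCommGroup F] [NormedSpace ℝ F]
    (u : TemperedDist F) (φ : 𝓢(Plane, ℝ)) : Continuous fun h => u (translate h φ) :=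
  u.continuous.comp (continuous_translate φ)

lemma integrable_smul_jet_translate (s : Finset (ℕ × ℕ)) (g φ : 𝓢(Plane, ℝ)) :
    Integrable fun h => g h • jet s (translate h φ) := by
  obtain ⟨C, k, hC⟩ := norm_jet_translate_le s φ
  refine ((integrable_norm_mul_one_add_pow g k).const_mul C).mono'
    (g.continuous.smul ((continuous_jet s).comp (continuous_translate φ))).aestronglyMeasurable
    (.of_forall fun h => ?_)
  rw [norm_smul, Real.norm_eq_abs]
  calc _ ≤ |g h| * (C * (1 + ‖h‖) ^ k) := by gcongr; exact hC h
    _ = _ := by ring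

lemma jet_schwartzConv (s : Finset (ℕ × ℕ)) (g φ : 𝓢(Plane, ℝ)) :
    jet s (schwartzConv g φ) = ∫ h, g h • jet s (translate h φ) := by
  have hint := integrable_smul_jet_translate s g φ
  funext i
  ext x m
  change weightedDeriv i.1.1 i.1.2 (schwartzConv g φ) x m =
    JetSpace.eval i x m (∫ h, g h • jet s (translate h φ))
  obtain ⟨B, hB⟩ := iteratedFDeriv_bounded φ i.1.2
  let ev : (Plane [×i.1.2]→L[ℝ] ℝ) →L[ℝ] ℝ := ContinuousMultilinearMap.apply ℝ _ ℝ m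
  have h1 : (∫ h, g h • iteratedFDeriv ℝ i.1.2 φ (x - h)) m =
      ∫ h, g h * iteratedFDeriv ℝ i.1.2 φ (x - h) m :=
    (ContinuousLinearMap.integral_comp_comm (𝕜 := ℝ) (E := Plane [×i.1.2]→L[ℝ] ℝ) (Fₗ := ℝ) ev
      (integrable_smul_comp_sub g (continuous_iteratedFDeriv φ i.1.2) hB x)).symm
  rw [← ContinuousLinearMap.integral_comp_comm _ hint, weightedDeriv_apply,
    iteratedFDeriv_schwartzConv, smul_apply, h1, smul_eq_mul,
    ← integral_const_mul]
  congr 1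
  funext h
  rw [map_smul, ← iteratedFDeriv_translate, smul_eq_mul, mul_left_comm]
  rfl

/-- A tempered distribution may be applied under the integral defining a convolution. -/
lemma apply_schwartzConv (u : TemperedDist ℝ) (g φ : 𝓢(Plane, ℝ)) :
    u (schwartzConv g φ) = ∫ h, g h * u (translate h φ) := by
  obtain ⟨s, w, hw⟩ := exists_extension_jet u
  rw [← hw, jet_schwartzConv, ← w.integral_comp_comm (integrable_smul_jet_translate s g φ)]
  simp [hw]

lemma integrable_mul_apply_translate (u : TemperedDist ℝ) (g φ : 𝓢(Plane, ℝ)) :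
    Integrable fun h => g h * u (translate h φ) := by
  obtain ⟨s, w, hw⟩ := exists_extension_jet u
  simpa [hw] using w.integrable_comp (integrable_smul_jet_translate s g φ)

lemma mollify_eq {F : Type*} [NormedAddCommGroup F] [NormedSpace ℝ F] (u : TemperedDist F) (T : ℝ)
    (x : Plane) : mollify u T x = u (translate x (heatKernel T)) := by
  rw [mollify, heatKernelAt_eq_translate]

lemma continuous_mollify {F : Type*} [NormedAddCommGroup F] [NormedSpace ℝ F] (u : TemperedDist F)
    (T : ℝ) : Continuous (mollify u T) := by
  simp_rw [funext (mollify_eq u T)]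
  exact continuous_apply_translate u _

lemma apply_schwartzConv_heatKernel (u : TemperedDist ℝ) (T : ℝ) (φ : 𝓢(Plane, ℝ)) :
    u (schwartzConv (heatKernel T) φ) = ∫ y, φ y * mollify u T y := by
  simp_rw [schwartzConv_comm (heatKernel T), apply_schwartzConv, mollify_eq]

lemma integrable_mul_mollify (u : TemperedDist ℝ) (T : ℝ) (φ : 𝓢(Plane, ℝ)) :
    Integrable fun y => φ y * mollify u T y := by
  simp_rw [mollify_eq]
  exact integrable_mul_apply_translate u φ _

/-- The semigroup property of the mollification. -/
lemma mollify_add (u : TemperedDist ℝ) {s t : ℝ} (hs : 0 < s) (ht : 0 < t) (x : Plane) :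
    mollify u (s + t) x = ∫ y, heatKernel s (x - y) * mollify u t y := by
  rw [mollify, add_comm, ← schwartzConv_heatKernelAt ht hs, apply_schwartzConv_heatKernel]
  simp_rw [heatKernelAt_apply]

lemma integrable_one_add_norm_pow_inv :
    Integrable fun x : Plane => ((1 + ‖x‖) ^ 3)⁻¹ := by
  have := integrable_one_add_norm (E := Plane) (μ := volume) (r := 3) (by simp; norm_num)
  refine this.congr (.of_forall fun x => ?_)
  have h : (0 : ℝ) ≤ 1 + ‖x‖ := by positivity
  simp only [Real.rpow_neg h]
  norm_cast

/-- The mass of the weight `(1 + ‖x‖)⁻³`. -/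
noncomputable def weightMass : ℝ := ∫ x : Plane, ((1 + ‖x‖) ^ 3)⁻¹

lemma weightMass_nonneg : 0 ≤ weightMass := integral_nonneg fun x => by positivity

lemma WeightedBound.integral_abs_le {B : ℝ} {φ : 𝓢(Plane, ℝ)} (h : WeightedBound 3 0 B φ) :
    ∫ x, |φ x| ≤ weightMass * B := by
  rw [weightMass, ← integral_mul_const]
  refine integral_mono φ.integrable.abs (integrable_one_add_norm_pow_inv.mul_const _) fun x => ?_
  have := h x
  rw [norm_iteratedFDeriv_zero, Real.norm_eq_abs] at this
  simp only
  rw [inv_mul_eq_div, le_div_iff₀ (by positivity), mul_comm]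
  exact this

lemma integrable_bcf_mul (f : Plane →ᵇ ℝ) (φ : 𝓢(Plane, ℝ)) : Integrable fun x => f x * φ x := by
  refine (φ.integrable.norm.const_mul ‖f‖).mono' (by fun_prop) (.of_forall fun x => ?_)
  rw [norm_mul]
  gcongr
  exact f.norm_coe_le_norm x

lemma abs_integral_bcf_mul_le (f : Plane →ᵇ ℝ) (φ : 𝓢(Plane, ℝ)) :
    |∫ x, f x * φ x| ≤ ‖f‖ * ∫ x, |φ x| := by
  rw [← integral_const_mul, ← Real.norm_eq_abs]
  refine norm_integral_le_of_norm_le (φ.integrable.abs.const_mul ‖f‖) (.of_forall fun x => ?_)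
  rw [norm_mul]
  exact mul_le_mul_of_nonneg_right (f.norm_coe_le_norm x) (norm_nonneg _)

/-- The tempered distribution given by a bounded continuous function. -/
noncomputable def boundedDist (f : Plane →ᵇ ℝ) : TemperedDist ℝ :=
  SchwartzMap.mkCLMtoNormedSpace (σ := RingHom.id ℝ) (fun φ => ∫ x, f x * φ x)
    (fun φ χ => by
      simp only [add_apply, mul_add]
      exact integral_add (integrable_bcf_mul f φ) (integrable_bcf_mul f χ))
    (fun a φ => by
      simp only [smul_apply, smul_eq_mul, RingHom.id_apply, ← integral_const_mul]
      congr 1; funext x; ring)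
    ⟨Finset.Iic (3, 0), ‖f‖ * (weightMass * 2 ^ 3), by
      have := weightMass_nonneg
      positivity, fun φ => by
      refine (abs_integral_bcf_mul_le f φ).trans ?_
      rw [mul_assoc, mul_assoc]
      exact mul_le_mul_of_nonneg_left
        (weightedBound_seminorm (3, 0) (3, 0) le_rfl le_rfl φ).integral_abs_le (norm_nonneg _)⟩

lemma boundedDist_apply (f : Plane →ᵇ ℝ) (φ : 𝓢(Plane, ℝ)) :
    boundedDist f φ = ∫ x, f x * φ x := rfl

lemma abs_boundedDist_le (f : Plane →ᵇ ℝ) (φ : 𝓢(Plane, ℝ)) :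
    |boundedDist f φ| ≤ ‖f‖ * ∫ x, |φ x| := abs_integral_bcf_mul_le f φ

/-- Convolution of Schwartz functions is associative. -/
lemma schwartzConv_assoc (g₁ g₂ φ : 𝓢(Plane, ℝ)) :
    schwartzConv (schwartzConv g₁ g₂) φ = schwartzConv g₁ (schwartzConv g₂ φ) := by
  ext x
  -- The function `φ(x - ·)`, tested against the convolution of `g₁` and `g₂`.
  let f : Plane →ᵇ ℝ := φ.toBoundedContinuousFunction.compContinuous ⟨fun h => x - h, by fun_prop⟩
  have h := apply_schwartzConv (boundedDist f) g₁ g₂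
  simp only [boundedDist_apply] at h
  calc _ = ∫ h, f h * schwartzConv g₁ g₂ h := by
        rw [schwartzConv_apply]
        exact integral_congr_ae (.of_forall fun h => mul_comm _ _)
    _ = _ := by
        rw [h, schwartzConv_apply]
        congr 1
        funext y
        congr 1
        rw [schwartzConv_apply,
          ← integral_sub_right_eq_self (fun z => g₂ z * φ (x - y - z)) y]
        congr 1
        funext z
        rw [SchwartzMap.compSubConstCLM_apply, mul_comm]
        congr 1
        change φ (x - z) = _
        congr 1
        abel

/-! ### The heat semigroup on Schwartz functions at dyadic times -/

/-- The heat semigroup on Schwartz functions. -/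
noncomputable abbrev heatFlow (T : ℝ) (φ : 𝓢(Plane, ℝ)) : 𝓢(Plane, ℝ) :=
  schwartzConv (heatKernel T) φ

/-- The increment of the heat semigroup from time `0` to time `T`. -/
noncomputable abbrev heatIncr (T : ℝ) (φ : 𝓢(Plane, ℝ)) : 𝓢(Plane, ℝ) := heatFlow T φ - φ

lemma heatFlow_heatFlow {s t : ℝ} (hs : 0 < s) (ht : 0 < t) (φ : 𝓢(Plane, ℝ)) :
    heatFlow s (heatFlow t φ) = heatFlow (s + t) φ := by
  rw [heatFlow, heatFlow, ← schwartzConv_assoc, schwartzConv_heatKernel hs ht]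

/-- With `S_t` the semigroup, `S_t - 1 = (S_{2t} - 1) / 2 - (S_t - 1)² / 2`. -/
lemma heatIncr_eq {t : ℝ} (ht : 0 < t) (φ : 𝓢(Plane, ℝ)) :
    heatIncr t φ = (1 / 2 : ℝ) • heatIncr (2 * t) φ +
      (-(1 / 2) : ℝ) • heatIncr t (heatIncr t φ) := by
  have h : heatIncr t (heatIncr t φ) =
      heatFlow (2 * t) φ - heatFlow t φ - (heatFlow t φ - φ) := by
    rw [heatIncr, heatIncr, heatFlow, schwartzConv_sub_right]
    rw [show schwartzConv (heatKernel t) (heatFlow t φ) = heatFlow (2 * t) φ by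
      rw [two_mul]; exact heatFlow_heatFlow ht ht φ]
  rw [h]
  module

lemma norm_parabolicScale_le {r : ℝ} (hr : 0 < r) (hr1 : r ≤ 1) (x : Plane) :
    ‖parabolicScale r hr.ne' x‖ ≤ r * ‖x‖ := by
  rw [← abs_of_nonneg (mul_nonneg hr.le (norm_nonneg x)), ← abs_of_nonneg (norm_nonneg (_ : Plane)),
    ← sq_le_sq, mul_pow]
  simp only [EuclideanSpace.norm_sq_eq, Fin.sum_univ_two, parabolicScale_zero, parabolicScale_one,
    Real.norm_eq_abs, sq_abs, mul_pow]
  have : (r ^ 2) ^ 2 ≤ r ^ 2 :=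
    pow_le_of_le_one (sq_nonneg r) (pow_le_one₀ hr.le hr1) two_ne_zero
  nlinarith [mul_le_mul_of_nonneg_right this (sq_nonneg (x 1))]

/-- The weighted mass of the heat kernel at unit time. -/
noncomputable def heatMass (k : ℕ) : ℝ := ∫ h, |heatKernel 1 h| * (1 + ‖h‖) ^ k

/-- The weighted first moment of the heat kernel at unit time. -/
noncomputable def heatMoment (k : ℕ) : ℝ := ∫ h, |heatKernel 1 h| * (‖h‖ * (1 + ‖h‖) ^ k)

lemma heatMass_nonneg (k : ℕ) : 0 ≤ heatMass k := integral_nonneg fun h => by positivity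

lemma heatMoment_nonneg (k : ℕ) : 0 ≤ heatMoment k := integral_nonneg fun h => by positivity

lemma integrable_heatMoment (g : 𝓢(Plane, ℝ)) (k : ℕ) :
    Integrable fun h => |g h| * (‖h‖ * (1 + ‖h‖) ^ k) := by
  refine integrable_abs_mul g (by fun_prop) (C := 1) (k := k + 1) fun h => ?_
  rw [abs_of_nonneg (by positivity), one_mul, pow_succ']
  gcongr
  linarith

lemma integral_heatKernel_weight_le {r : ℝ} (hr : 0 < r) (hr1 : r ≤ 1) (k : ℕ) :
    ∫ h, |heatKernel (r ^ 4) h| * (1 + ‖h‖) ^ k ≤ heatMass k := by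
  rw [integral_abs_heatKernel_mul hr, heatMass]
  refine integral_mono_of_nonneg (.of_forall fun h => by positivity)
    (integrable_norm_mul_one_add_pow _ k) (.of_forall fun h => ?_)
  simp only
  gcongr
  exact (norm_parabolicScale_le hr hr1 h).trans (mul_le_of_le_one_left (norm_nonneg _) hr1)

lemma integral_heatKernel_moment_le {r : ℝ} (hr : 0 < r) (hr1 : r ≤ 1) (k : ℕ) :
    ∫ h, |heatKernel (r ^ 4) h| * (‖h‖ * (1 + ‖h‖) ^ k) ≤ heatMoment k * r := by
  rw [integral_abs_heatKernel_mul hr, heatMoment, ← integral_mul_const]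
  refine integral_mono_of_nonneg (.of_forall fun h => by positivity)
    ((integrable_heatMoment _ k).mul_const r) (.of_forall fun h => ?_)
  have h1 := norm_parabolicScale_le hr hr1 h
  have h2 := h1.trans (mul_le_of_le_one_left (norm_nonneg h) hr1)
  simp only
  calc _ ≤ |heatKernel 1 h| * ((r * ‖h‖) * (1 + ‖h‖) ^ k) := by gcongr
    _ = _ := by ring

lemma WeightedBound.heatFlow {k n : ℕ} {B r : ℝ} {φ : 𝓢(Plane, ℝ)} (h : WeightedBound k n B φ)
    (hr : 0 < r) (hr1 : r ≤ 1) :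
    WeightedBound k n (heatMass k * B) (heatFlow (r ^ 4) φ) :=
  (h.conv_right _).mono
    (mul_le_mul_of_nonneg_right (integral_heatKernel_weight_le hr hr1 k) h.nonneg)

lemma WeightedBound.heatIncr {k n : ℕ} {B r : ℝ} {φ : 𝓢(Plane, ℝ)} (h : WeightedBound k (n + 1) B φ)
    (hr : 0 < r) (hr1 : r ≤ 1) :
    WeightedBound k n (heatMoment k * r * B) (heatIncr (r ^ 4) φ) :=
  (h.schwartzConv_sub _ (integral_heatKernel (by positivity))).mono
    (mul_le_mul_of_nonneg_right (integral_heatKernel_moment_le hr hr1 k) h.nonneg)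

lemma fourth_root_pow {T : ℝ} (hT : 0 ≤ T) : (T ^ (1 / 4 : ℝ)) ^ 4 = T := by
  rw [← Real.rpow_natCast, ← Real.rpow_mul hT]; norm_num

lemma exists_fourth_root_half : ∃ q : ℝ, 0 < q ∧ q < 1 ∧ q ^ 4 = 1 / 2 ∧ q ^ 2 ≤ 71 / 100 := by
  refine ⟨(1 / 2 : ℝ) ^ (1 / 4 : ℝ), by positivity,
    Real.rpow_lt_one (by norm_num) (by norm_num) (by norm_num), fourth_root_pow (by norm_num), ?_⟩
  have : ((1 / 2 : ℝ) ^ (1 / 4 : ℝ)) ^ 4 = 1 / 2 := fourth_root_pow (by norm_num)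
  set q := (1 / 2 : ℝ) ^ (1 / 4 : ℝ)
  nlinarith [sq_nonneg q]

/-- The increment over a dyadic time `t` is of order `t^{1/2}`: the quadratic term in `heatIncr_eq`
has twice the trivial rate `t^{1/4}`, and the linear term is contracted in passing from `2t` to
`t`. -/
lemma exists_weightedBound_heatIncr_sqrt (k : ℕ) {q : ℝ} (hq0 : 0 < q) (hq1 : q < 1)
    (hq4 : q ^ 4 = 1 / 2) (hq2 : q ^ 2 ≤ 71 / 100) :
    ∃ c : ℝ, 0 ≤ c ∧ ∀ (n : ℕ) (B : ℝ) (φ : 𝓢(Plane, ℝ)), WeightedBound k (n + 1) B φ →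
      WeightedBound k (n + 2) B φ → ∀ j : ℕ,
        WeightedBound k n (c * (q ^ j) ^ 2 * B) (heatIncr ((1 / 2) ^ j) φ) := by
  set M := heatMoment k with hM
  have hM0 : 0 ≤ M := heatMoment_nonneg k
  have hτ : ∀ j : ℕ, (q ^ j) ^ 4 = (1 / 2 : ℝ) ^ j := fun j => by rw [← hq4]; ring
  have hqj : ∀ j : ℕ, q ^ j ≤ 1 := fun j => pow_le_one₀ hq0.le hq1.le
  refine ⟨2 * M ^ 2 + M, by positivity, fun n B φ h1 h2 j => ?_⟩
  have hB := h1.nonneg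
  induction j with
  | zero =>
    have := h1.heatIncr (r := q ^ 0) (by positivity) (hqj 0)
    rw [hτ] at this
    refine this.mono ?_
    rw [← hM, pow_zero, one_pow, mul_one, mul_one]
    gcongr
    nlinarith
  | succ j ih =>
    have hsq : WeightedBound k n (M * q ^ (j + 1) * (M * q ^ (j + 1) * B))
        (Reconstruction.heatIncr ((1 / 2) ^ (j + 1))
          (Reconstruction.heatIncr ((1 / 2) ^ (j + 1)) φ)) := by
      rw [← hτ]
      exact (h2.heatIncr (by positivity) (hqj _)).heatIncr (by positivity) (hqj _)
    rw [heatIncr_eq (by positivity) φ]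
    have h2t : 2 * (1 / 2 : ℝ) ^ (j + 1) = (1 / 2) ^ j := by ring
    rw [h2t]
    refine ((ih.smul (1 / 2)).add (hsq.smul (-(1 / 2)))).mono ?_
    rw [abs_neg, abs_of_pos (by norm_num : (0 : ℝ) < 1 / 2)]
    -- The contraction factor `1/2` beats the decay `q² ≈ 0.707` of the claimed bound in one dyadic
    -- step, and the choice of `c` leaves room for the quadratic term.
    have hkey : 1 / 2 * (2 * M ^ 2 + M) + 1 / 2 * M ^ 2 * q ^ 2 ≤ (2 * M ^ 2 + M) * q ^ 2 := by
      have h4 : q ^ 2 * q ^ 2 = 1 / 2 := by rw [← hq4]; ring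
      have h5 : 1 / 2 * M ^ 2 ≤ (2 * M ^ 2 + M) * (1 - q ^ 2) := by
        nlinarith [mul_nonneg (by positivity : 0 ≤ 2 * M ^ 2 + M) (by linarith :
          0 ≤ 71 / 100 - q ^ 2)]
      nlinarith [mul_le_mul_of_nonneg_right h5 (sq_nonneg q)]
    calc _ = (1 / 2 * (2 * M ^ 2 + M) + 1 / 2 * M ^ 2 * q ^ 2) * ((q ^ j) ^ 2 * B) := by ring
      _ ≤ ((2 * M ^ 2 + M) * q ^ 2) * ((q ^ j) ^ 2 * B) := by gcongr
      _ = _ := by ring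

/-- The increment over a dyadic time `t` is of order `t log(1/t)`, which is one logarithm away from
the optimal rate; obtained from `exists_weightedBound_heatIncr_sqrt` by the same argument. -/
lemma exists_weightedBound_heatIncr (k : ℕ) :
    ∃ d : ℝ, 0 ≤ d ∧ ∀ (B : ℝ) (φ : 𝓢(Plane, ℝ)), (∀ i ≤ 4, WeightedBound k i B φ) →
      ∀ j : ℕ, WeightedBound k 0 (d * ((j + 1) * (1 / 2) ^ j) * B) (heatIncr ((1 / 2) ^ j) φ) := by
  obtain ⟨q, hq0, hq1, hq4, hq2⟩ := exists_fourth_root_half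
  obtain ⟨c, hc0, hc⟩ := exists_weightedBound_heatIncr_sqrt k hq0 hq1 hq4 hq2
  have hτ : ∀ j : ℕ, (q ^ j) ^ 2 * (q ^ j) ^ 2 = (1 / 2 : ℝ) ^ j := fun j => by rw [← hq4]; ring
  refine ⟨c + c ^ 2, by positivity, fun B φ h j => ?_⟩
  have hB := (h 0 (by norm_num)).nonneg
  induction j with
  | zero =>
    refine (hc 0 B φ (h 1 (by norm_num)) (h 2 (by norm_num)) 0).mono ?_
    simp only [pow_zero, Nat.cast_zero, one_pow, mul_one, zero_add]
    gcongr
    nlinarith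
  | succ j ih =>
    have hsq : WeightedBound k 0 (c * (q ^ (j + 1)) ^ 2 * (c * (q ^ (j + 1)) ^ 2 * B))
        (Reconstruction.heatIncr ((1 / 2) ^ (j + 1))
          (Reconstruction.heatIncr ((1 / 2) ^ (j + 1)) φ)) :=
      hc 0 _ _ (hc 1 B φ (h 2 (by norm_num)) (h 3 (by norm_num)) _)
        (hc 2 B φ (h 3 (by norm_num)) (h 4 (by norm_num)) _) _
    rw [heatIncr_eq (by positivity) φ]
    have h2t : 2 * (1 / 2 : ℝ) ^ (j + 1) = (1 / 2) ^ j := by ring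
    rw [h2t]
    refine ((ih.smul (1 / 2)).add (hsq.smul (-(1 / 2)))).mono ?_
    rw [abs_neg, abs_of_pos (by norm_num : (0 : ℝ) < 1 / 2)]
    have : c * (q ^ (j + 1)) ^ 2 * (c * (q ^ (j + 1)) ^ 2 * B) = c ^ 2 * (1 / 2) ^ (j + 1) * B := by
      rw [← hτ]; ring
    rw [this]
    push_cast
    calc _ = ((c + c ^ 2) * (j + 1) + 1 / 2 * c ^ 2) * ((1 / 2) ^ (j + 1) * B) := by ring
      _ ≤ ((c + c ^ 2) * (j + 1 + 1)) * ((1 / 2) ^ (j + 1) * B) := by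
          gcongr
          nlinarith
      _ = _ := by ring

lemma mollify_sub (u w : TemperedDist ℝ) (T : ℝ) (x : Plane) :
    mollify (u - w) T x = mollify u T x - mollify w T x := rfl

/-- The heat semigroup is continuous at time `0` in the Schwartz topology. -/
lemma tendsto_heatFlow (φ : 𝓢(Plane, ℝ)) :
    Tendsto (fun r : ℝ => heatFlow (r ^ 4) φ) (𝓝[>] 0) (𝓝 φ) := by
  rw [(schwartz_withSeminorms ℝ Plane ℝ).tendsto_nhds _ _]
  rintro ⟨k, n⟩ ε hε
  obtain ⟨B, hB⟩ := exists_weightedBound k (n + 1) φ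
  have hlim : Tendsto (fun r : ℝ => heatMoment k * r * B) (𝓝[>] 0) (𝓝 0) := by
    have : Continuous (fun r : ℝ => heatMoment k * r * B) := by fun_prop
    simpa using (this.tendsto 0).mono_left nhdsWithin_le_nhds
  filter_upwards [hlim.eventually_lt_const hε, self_mem_nhdsWithin,
    mem_nhdsWithin_of_mem_nhds (Iic_mem_nhds (zero_lt_one' ℝ))] with r h1 h2 h3
  refine lt_of_le_of_lt ?_ h1
  have h4 := hB.heatIncr h2 h3
  refine SchwartzMap.seminorm_le_bound ℝ k n _ h4.nonneg fun x => le_trans ?_ (h4 x)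
  gcongr
  linarith

/-- A tempered distribution whose mollifications tend to zero uniformly vanishes. -/
lemma eq_zero_of_mollify_le {u : TemperedDist ℝ} {C a : ℝ} (ha : 0 < a)
    (h : ∀ (T : ℝ) (x : Plane), 0 < T → T ≤ 1 → |mollify u T x| ≤ C * (T ^ (1 / 4 : ℝ)) ^ a) :
    u = 0 := by
  ext φ
  have h1 : Tendsto (fun r : ℝ => u (heatFlow (r ^ 4) φ)) (𝓝[>] 0) (𝓝 (u φ)) :=
    (u.continuous.tendsto φ).comp (tendsto_heatFlow φ)
  have hlim : Tendsto (fun r : ℝ => C * r ^ a * ∫ y, |φ y|) (𝓝[>] 0) (𝓝 0) := by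
    have : Continuous (fun r : ℝ => C * r ^ a * ∫ y, |φ y|) := by
      have := Real.continuous_rpow_const ha.le
      fun_prop
    simpa [Real.zero_rpow ha.ne'] using (this.tendsto 0).mono_left nhdsWithin_le_nhds
  have h2 : Tendsto (fun r : ℝ => u (heatFlow (r ^ 4) φ)) (𝓝[>] 0) (𝓝 0) := by
    refine squeeze_zero_norm' ?_ hlim
    filter_upwards [self_mem_nhdsWithin,
      mem_nhdsWithin_of_mem_nhds (Iic_mem_nhds (zero_lt_one' ℝ))] with r (hr0 : 0 < r) hr1
    rw [apply_schwartzConv_heatKernel, ← integral_const_mul]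
    refine norm_integral_le_of_norm_le (φ.integrable.abs.const_mul _) (.of_forall fun y => ?_)
    have hr : (r ^ 4) ^ (1 / 4 : ℝ) = r := by
      rw [← Real.rpow_natCast, ← Real.rpow_mul hr0.le]; norm_num
    have := h (r ^ 4) y (by positivity) (pow_le_one₀ hr0.le hr1)
    rw [hr] at this
    rw [norm_mul, mul_comm, Real.norm_eq_abs, Real.norm_eq_abs]
    gcongr
  exact tendsto_nhds_unique h1 h2

/-! ### Reconstruction from approximately coherent approximations -/

/-- Tempered distributions whose successive differences are summable, uniformly with respect to a
Schwartz seminorm, converge weakly to a tempered distribution. -/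
lemma exists_limit_temperedDist (u : ℕ → TemperedDist ℝ) (s : Finset (ℕ × ℕ)) {e : ℕ → ℝ}
    (he : Summable e) (he0 : ∀ n, 0 ≤ e n)
    (h : ∀ n φ, |u (n + 1) φ - u n φ| ≤ e n * s.sup (schwartzSeminormFamily ℝ Plane ℝ) φ) :
    ∃ R : TemperedDist ℝ, ∀ φ, Tendsto (fun n => u n φ) atTop (𝓝 (R φ)) := by
  have hd : ∀ φ n, dist (u n φ) (u (n + 1) φ) ≤
      e n * s.sup (schwartzSeminormFamily ℝ Plane ℝ) φ := fun φ n => by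
    rw [dist_comm]; exact h n φ
  have hsum : ∀ φ, Summable fun n => e n * s.sup (schwartzSeminormFamily ℝ Plane ℝ) φ :=
    fun φ => he.mul_right _
  have hlim : ∀ φ, ∃ a, Tendsto (fun n => u n φ) atTop (𝓝 a) := fun φ =>
    cauchySeq_tendsto_of_complete (cauchySeq_of_dist_le_of_summable _ (hd φ) (hsum φ))
  choose a ha using hlim
  have hadd : ∀ φ χ, a (φ + χ) = a φ + a χ := fun φ χ =>
    tendsto_nhds_unique (ha (φ + χ)) (by simpa using (ha φ).add (ha χ))
  have hsmul : ∀ (c : ℝ) φ, a (c • φ) = c * a φ := fun c φ =>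
    tendsto_nhds_unique (ha (c • φ)) (by simpa using (ha φ).const_mul c)
  let D : TemperedDist ℝ := SchwartzMap.mkCLMtoNormedSpace (σ := RingHom.id ℝ)
    (fun φ => a φ - u 0 φ)
    (fun φ χ => by rw [hadd, map_add]; ring)
    (fun c φ => by rw [hsmul, map_smul, RingHom.id_apply, smul_eq_mul, smul_eq_mul]; ring)
    ⟨s, ∑' n, e n, tsum_nonneg he0, fun φ => by
      have := dist_le_tsum_of_dist_le_of_tendsto₀ _ (hd φ) (hsum φ) (ha φ)
      rw [tsum_mul_right, dist_comm] at this
      exact this⟩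
  refine ⟨D + u 0, fun φ => ?_⟩
  have : (D + u 0) φ = a φ := sub_add_cancel (a φ) (u 0 φ)
  rw [this]
  exact ha φ

lemma heatKernelAt_abs_integral {T : ℝ} (hT : 0 < T) (x : Plane) :
    ∫ y, |heatKernelAt T x y| = heatMass 0 := by
  simp_rw [heatKernelAt_apply]
  rw [integral_sub_left_eq_self (fun y => |heatKernel T y|) volume x, heatMass]
  have hr : 0 < T ^ (1 / 4 : ℝ) := Real.rpow_pos_of_pos hT _
  have := integral_abs_heatKernel_mul hr (fun _ => 1)
  rw [fourth_root_pow hT.le] at this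
  simpa using this

lemma mollify_boundedDist_sub_le {f : ℝ → Plane →ᵇ ℝ} {K α : ℝ}
    (hK : ∀ (s t : ℝ) (x : Plane), 0 < s → s ≤ t → s + t ≤ 1 →
      |mollify (boundedDist (f t)) s x - f (s + t) x| ≤ K * t ^ (α / 4))
    {s t : ℝ} (hs : 0 < s) (hst : s ≤ t) (hst1 : s + t ≤ 1) (φ : 𝓢(Plane, ℝ)) :
    |boundedDist (f t) (heatFlow s φ) - boundedDist (f (s + t)) φ| ≤
      K * t ^ (α / 4) * ∫ y, |φ y| := by
  have h2 := integrable_bcf_mul (f (s + t)) φ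
  simp_rw [mul_comm (f (s + t) _)] at h2
  rw [apply_schwartzConv_heatKernel, boundedDist_apply]
  simp_rw [mul_comm (f (s + t) _)]
  rw [← integral_sub (integrable_mul_mollify _ s φ) h2, ← integral_const_mul,
    ← Real.norm_eq_abs]
  refine norm_integral_le_of_norm_le (φ.integrable.abs.const_mul _) (.of_forall fun y => ?_)
  rw [← mul_sub, norm_mul, mul_comm, Real.norm_eq_abs, Real.norm_eq_abs]
  exact mul_le_mul_of_nonneg_right (hK s t y hs hst hst1) (abs_nonneg _)

lemma half_pow_rpow (n : ℕ) (a : ℝ) : ((1 / 2 : ℝ) ^ n) ^ a = ((1 / 2 : ℝ) ^ a) ^ n := by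
  rw [← Real.rpow_natCast, ← Real.rpow_mul (by norm_num), mul_comm, Real.rpow_mul (by norm_num),
    Real.rpow_natCast]

/-- Bounded functions `f_t` with a mild blow up as `t → 0` which are almost compatible with the
semigroup, `f_t * ψ_s = f_{s+t} + O(t^{α/4})`, are almost the mollifications of a distribution. -/
theorem exists_temperedDist_of_almost_semigroup (α : ℝ) (hα : 0 < α) :
    ∃ C : ℝ, 0 < C ∧ ∀ (f : ℝ → Plane →ᵇ ℝ) (b B K : ℝ), -4 < b → 0 ≤ B → 0 ≤ K →
      (∀ t, 0 < t → t ≤ 1 → ‖f t‖ ≤ B * t ^ (b / 4)) →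
      (∀ (s t : ℝ) (x : Plane), 0 < s → s ≤ t → s + t ≤ 1 →
        |mollify (boundedDist (f t)) s x - f (s + t) x| ≤ K * t ^ (α / 4)) →
      ∃ R : TemperedDist ℝ, ∀ (T : ℝ) (x : Plane), 0 < T → T ≤ 1 →
        |mollify R T x - f T x| ≤ C * K * T ^ (α / 4) := by
  set ρ : ℝ := (1 / 2 : ℝ) ^ (α / 4) with hρ
  have hρ0 : 0 < ρ := by positivity
  have hρ1 : ρ < 1 := Real.rpow_lt_one (by norm_num) (by norm_num) (by positivity)
  have hm0 := heatMass_nonneg 0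
  have h1ρ : 0 < 1 - ρ := by linarith
  obtain ⟨d, hd0, hd⟩ := exists_weightedBound_heatIncr 3
  refine ⟨1 + heatMass 0 * ρ / (1 - ρ), by positivity, fun f b B K hb hB0 hK0 hB hK => ?_⟩
  set σ : ℝ := (1 / 2 : ℝ) ^ (b / 4 + 1) with hσ
  have hσ0 : 0 < σ := by positivity
  have hσ1 : σ < 1 := Real.rpow_lt_one (by norm_num) (by norm_num) (by linarith)
  have hW := weightMass_nonneg
  have hσpow : ∀ n : ℕ, ((1 / 2 : ℝ) ^ n) ^ (b / 4) * (1 / 2) ^ n = σ ^ n := fun n => by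
    rw [hσ, Real.rpow_add (by norm_num), Real.rpow_one, mul_pow, half_pow_rpow]
  have hτ0 : ∀ n : ℕ, (0 : ℝ) < (1 / 2) ^ n := fun n => by positivity
  have hτ1 : ∀ n : ℕ, ((1 / 2 : ℝ)) ^ n ≤ 1 := fun n => pow_le_one₀ (by norm_num) (by norm_num)
  have hτ2 : ∀ n : ℕ, (1 / 2 : ℝ) ^ (n + 1) + (1 / 2) ^ (n + 1) = (1 / 2) ^ n := fun n => by ring
  have hsumσ : Summable fun n : ℕ => ((n : ℝ) + 1) * σ ^ n := by
    have h1 := summable_pow_mul_geometric_of_norm_lt_one (R := ℝ) 1 (r := σ)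
      (by rwa [Real.norm_of_nonneg hσ0.le])
    have h2 := summable_geometric_of_lt_one hσ0.le hσ1
    refine (h1.add h2).congr fun n => ?_
    ring
  -- The dyadic increments of the pairing with a test function.
  have hincr : ∀ n φ Q, (∀ i ≤ 4, WeightedBound 3 i Q φ) →
      |boundedDist (f ((1 / 2) ^ (n + 1))) φ - boundedDist (f ((1 / 2) ^ n)) φ| ≤
        (weightMass * (K * ρ ^ (n + 1) + B * d * (((n + 1 : ℕ) + 1) * σ ^ (n + 1)))) * Q := by
    intro n φ Q hQ
    have h1 := mollify_boundedDist_sub_le hK (hτ0 (n + 1)) le_rfl (by rw [hτ2]; exact hτ1 n) φ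
    rw [hτ2, half_pow_rpow, ← hρ] at h1
    have h2 := abs_boundedDist_le (f ((1 / 2) ^ (n + 1))) (heatIncr ((1 / 2) ^ (n + 1)) φ)
    have h3 := (hQ 0 (by norm_num)).integral_abs_le
    have h4 := (hd Q φ hQ (n + 1)).integral_abs_le
    have h5 := hB ((1 / 2) ^ (n + 1)) (hτ0 _) (hτ1 _)
    have hQ0 := (hQ 0 (by norm_num)).nonneg
    have h6 : boundedDist (f ((1 / 2) ^ (n + 1))) (heatIncr ((1 / 2) ^ (n + 1)) φ) =
        boundedDist (f ((1 / 2) ^ (n + 1))) (heatFlow ((1 / 2) ^ (n + 1)) φ) -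
          boundedDist (f ((1 / 2) ^ (n + 1))) φ := map_sub _ _ _
    have h7 : |boundedDist (f ((1 / 2) ^ (n + 1))) (heatIncr ((1 / 2) ^ (n + 1)) φ)| ≤
        B * ((1 / 2 : ℝ) ^ (n + 1)) ^ (b / 4) *
          (weightMass * (d * (((n + 1 : ℕ) + 1) * (1 / 2) ^ (n + 1)) * Q)) :=
      h2.trans (mul_le_mul h5 h4 (integral_nonneg fun _ => abs_nonneg _) (by positivity))
    have h8 : K * ρ ^ (n + 1) * ∫ y, |φ y| ≤ K * ρ ^ (n + 1) * (weightMass * Q) := by gcongr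
    rw [h6] at h7
    rw [abs_sub_comm] at h7
    rw [abs_sub_comm]
    calc _ ≤ _ := by
          rw [abs_sub_comm]
          exact abs_sub_le _ (boundedDist (f ((1 / 2) ^ (n + 1)))
            (heatFlow ((1 / 2) ^ (n + 1)) φ)) _
      _ ≤ _ := add_le_add h7 (h1.trans h8)
      _ = _ := by rw [← hσpow]; ring
  obtain ⟨R, hR⟩ := exists_limit_temperedDist (fun n => boundedDist (f ((1 / 2) ^ n)))
    (Finset.Iic (3, 4))
    (e := fun n => (weightMass *
      (K * ρ ^ (n + 1) + B * d * (((n + 1 : ℕ) + 1) * σ ^ (n + 1)))) * 2 ^ 3)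
    (by
      refine Summable.mul_right _ (Summable.mul_left _ (Summable.add ?_ ?_))
      · exact ((summable_nat_add_iff 1).2 (summable_geometric_of_lt_one hρ0.le hρ1)).mul_left K
      · exact ((summable_nat_add_iff 1).2 hsumσ).mul_left _)
    (fun n => by positivity)
    (fun n φ => by
      rw [mul_assoc]
      exact hincr n φ _ fun i hi => weightedBound_seminorm (3, 4) (3, i) le_rfl hi φ)
  refine ⟨R, fun T x hT hT1 => ?_⟩
  obtain ⟨m, hm1, hm2⟩ := exists_nat_pow_near_of_lt_one hT hT1 (by norm_num : (0 : ℝ) < 1 / 2)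
    (by norm_num)
  -- The dyadic time with `2⁻ᴺ < T ≤ 2 · 2⁻ᴺ`; for it, `s = T - 2⁻ᴺ` is at most `t = 2⁻ᴺ`.
  set N := m + 1 with hN
  have hTN : 0 < T - (1 / 2) ^ N := by linarith
  have hlt : ∀ j : ℕ, (1 / 2 : ℝ) ^ (N + j) ≤ (1 / 2) ^ N := fun j =>
    pow_le_pow_of_le_one (by norm_num) (by norm_num) (Nat.le_add_right _ _)
  have hTj : ∀ j : ℕ, 0 < T - (1 / 2) ^ (N + j) := fun j => by linarith [hlt j]
  -- Mollifying `f_t` up to the total scale `T` telescopes along dyadic `t`.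
  set D : ℕ → ℝ := fun j => mollify (boundedDist (f ((1 / 2) ^ (N + j)))) (T - (1 / 2) ^ (N + j)) x
    with hD
  have hD0 : |D 0 - f T x| ≤ K * T ^ (α / 4) := by
    have h1 := hK (T - (1 / 2) ^ N) ((1 / 2) ^ N) x hTN (by rw [← hτ2] at hm2; linarith)
      (by linarith)
    rw [sub_add_cancel] at h1
    refine h1.trans ?_
    gcongr
  have hDstep : ∀ j, dist (D j) (D (j + 1)) ≤ K * heatMass 0 * ρ ^ (N + 1) * ρ ^ j := by
    intro j
    have h1 := mollify_boundedDist_sub_le hK (hτ0 (N + j + 1)) le_rfl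
      (by rw [hτ2]; exact hτ1 _) (heatKernelAt (T - (1 / 2) ^ (N + j)) x)
    rw [hτ2, heatFlow, schwartzConv_heatKernelAt (hτ0 _) (hTj j), half_pow_rpow, ← hρ,
      heatKernelAt_abs_integral (hTj j)] at h1
    have h2 : (1 / 2 : ℝ) ^ (N + j + 1) + (T - (1 / 2) ^ (N + j)) =
        T - (1 / 2) ^ (N + (j + 1)) := by
      rw [← hτ2 (N + j)]; ring
    rw [h2] at h1
    rw [dist_comm, Real.dist_eq]
    refine h1.trans (le_of_eq ?_)
    ring
  have hDlim : Tendsto D atTop (𝓝 (mollify R T x)) := by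
    have h1 : Tendsto (fun j => boundedDist (f ((1 / 2) ^ (N + j))) (heatKernelAt T x)) atTop
        (𝓝 (mollify R T x)) := by
      have := (tendsto_add_atTop_iff_nat N).2 (hR (heatKernelAt T x))
      simpa only [add_comm, mollify] using this
    set χ := heatKernelAt (T - (1 / 2) ^ N) x with hχ
    obtain ⟨Q, hQ⟩ : ∃ Q, ∀ i ≤ 4, WeightedBound 3 i Q χ :=
      ⟨_, fun i hi => weightedBound_seminorm (3, 4) (3, i) le_rfl hi χ⟩
    have h2 : Tendsto (fun j : ℕ => B * (weightMass * (heatMass 3 * (d * Q))) *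
        ((((j + N : ℕ) : ℝ) + 1) * σ ^ (j + N))) atTop (𝓝 0) := by
      have := ((tendsto_add_atTop_iff_nat N).2 hsumσ.tendsto_atTop_zero).const_mul
        (B * (weightMass * (heatMass 3 * (d * Q))))
      rwa [mul_zero] at this
    -- Both terms contain the fixed heat kernel at time `T - 2⁻ᴺ`, so that the rate for the flow
    -- applies to a fixed Schwartz function.
    have h3 : Tendsto (fun j => D j - boundedDist (f ((1 / 2) ^ (N + j))) (heatKernelAt T x)) atTop
        (𝓝 0) := by
      refine squeeze_zero_norm' ?_ h2
      filter_upwards [eventually_ge_atTop 1] with j hj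
      set t : ℝ := (1 / 2) ^ (N + j) with ht
      have ht0 : 0 < t := hτ0 _
      have htN : 0 < (1 / 2) ^ N - t := by
        have : t ≤ (1 / 2 : ℝ) ^ (N + 1) :=
          pow_le_pow_of_le_one (by norm_num) (by norm_num) (by omega)
        have h2 := hτ2 N
        have h3 := hτ0 (N + 1)
        linarith
      have e1 : heatKernelAt (T - t) x = heatFlow ((1 / 2) ^ N - t) χ := by
        rw [heatFlow, hχ, schwartzConv_heatKernelAt htN hTN]; congr 1; ring
      have e2 : heatKernelAt T x = heatFlow ((1 / 2) ^ N - t) (heatFlow t χ) := by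
        rw [heatFlow, heatFlow, hχ, schwartzConv_heatKernelAt ht0 hTN,
          schwartzConv_heatKernelAt htN (by linarith)]; congr 1; ring
      have e3 : heatKernelAt (T - t) x - heatKernelAt T x =
          -heatFlow ((1 / 2) ^ N - t) (heatIncr t χ) := by
        rw [e1, e2, show heatFlow ((1 / 2) ^ N - t) (heatIncr t χ) =
          heatFlow ((1 / 2) ^ N - t) (heatFlow t χ) - heatFlow ((1 / 2) ^ N - t) χ from
          schwartzConv_sub_right _ _ _, neg_sub]
      have e4 : D j - boundedDist (f t) (heatKernelAt T x) =
          -boundedDist (f t) (heatFlow ((1 / 2) ^ N - t) (heatIncr t χ)) := by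
        rw [← map_neg, ← e3, map_sub]; rfl
      obtain ⟨r, hr0, hr1, hr4⟩ : ∃ r : ℝ, 0 < r ∧ r ≤ 1 ∧ r ^ 4 = (1 / 2) ^ N - t := by
        refine ⟨((1 / 2) ^ N - t) ^ (1 / 4 : ℝ), by positivity, ?_, fourth_root_pow htN.le⟩
        exact Real.rpow_le_one htN.le (by linarith [hτ1 N]) (by norm_num)
      have e5 := ((hd Q χ hQ (N + j)).heatFlow hr0 hr1).integral_abs_le
      rw [hr4] at e5
      have e6 := hB t ht0 (hτ1 _)
      rw [e4, norm_neg, Real.norm_eq_abs]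
      refine (abs_boundedDist_le _ _).trans ?_
      calc _ ≤ B * t ^ (b / 4) * (weightMass * (heatMass 3 *
            (d * (((N + j : ℕ) + 1) * (1 / 2) ^ (N + j)) * Q))) :=
            mul_le_mul e6 e5 (integral_nonneg fun _ => abs_nonneg _) (by positivity)
        _ = _ := by rw [add_comm j N, ← hσpow, ← ht]; ring
    simpa using h3.add h1
  have hfin := dist_le_of_le_geometric_of_tendsto₀ ρ _ hρ1 hDstep hDlim
  have hρT : ρ ^ N ≤ T ^ (α / 4) := by
    rw [hρ, ← half_pow_rpow]
    exact Real.rpow_le_rpow (hτ0 N).le (by linarith) (by positivity)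
  have h9 : K * heatMass 0 * ρ ^ (N + 1) / (1 - ρ) ≤
      K * T ^ (α / 4) * (heatMass 0 * ρ / (1 - ρ)) := by
    calc _ = K * ρ ^ N * (heatMass 0 * ρ / (1 - ρ)) := by ring
      _ ≤ _ := by gcongr
  rw [dist_comm, Real.dist_eq] at hfin
  calc _ ≤ |mollify R T x - D 0| + |D 0 - f T x| := abs_sub_le _ _ _
    _ ≤ _ := add_le_add (hfin.trans h9) hD0
    _ = _ := by ring

/-! ### Continuity of modelled distributions at large distances -/

lemma le_sInf_mul {S : Set ℝ} (hS : S.Nonempty) {a s : ℝ} (hs : 0 ≤ s) (h : ∀ c ∈ S, a ≤ c * s) :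
    a ≤ sInf S * s := by
  rcases hs.eq_or_lt with rfl | hs
  · obtain ⟨c, hc⟩ := hS
    simpa using h c hc
  · rw [← div_le_iff₀ hs]
    exact le_csInf hS fun c hc => (div_le_iff₀ hs).2 (h c hc)

lemma parabolicDist_nonneg (x y : Plane) : 0 ≤ parabolicDist x y :=
  add_nonneg (abs_nonneg _) (Real.sqrt_nonneg _)

section

variable {A : Finset ℝ} {E : A → Type*} [∀ β, NormedAddCommGroup (E β)] [∀ β, NormedSpace ℝ (E β)]
  {Γ : Plane → (∀ β, E β) →L[ℝ] (∀ β, E β)} {V : Plane → (∀ β, E β) →L[ℝ] ℝ} {α : ℝ}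

lemma skeletonNorm_nonneg : 0 ≤ skeletonNorm Γ := Real.sInf_nonneg fun _ h => h.1

lemma formSeminorm_nonneg : 0 ≤ formSeminorm Γ α V := Real.sInf_nonneg fun _ h => h.1

lemma skeletonContinuityWith_skeletonNorm (hΓ : IsSkeleton Γ) :
    SkeletonContinuityWith Γ (skeletonNorm Γ) := fun β v x y hxy => by
  refine le_sInf_mul hΓ.exists_continuityWith ?_ fun C hC => hC.2 β v x y hxy
  exact Finset.sum_nonneg fun γ _ =>
    mul_nonneg (Real.rpow_nonneg (parabolicDist_nonneg _ _) _) (norm_nonneg _)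

lemma formContinuousWith_formSeminorm (hV : IsModelledDistribution Γ α V) :
    FormContinuousWith Γ α V (formSeminorm Γ α V) := fun v x y hxy => by
  refine le_sInf_mul hV.exists_continuousWith ?_ fun M hM => hM.2 v x y hxy
  exact Finset.sum_nonneg fun γ _ =>
    mul_nonneg (Real.rpow_nonneg (parabolicDist_nonneg _ _) _) (norm_nonneg _)

/-- The number of homogeneities below `β`. -/
noncomputable def rank (β : A) : ℕ := (Finset.univ.filter (· < β)).card

lemma rank_lt_rank {γ β : A} (h : γ < β) : rank γ < rank β := by
  refine Finset.card_lt_card ((Finset.ssubset_iff_of_subset fun δ hδ => ?_).2 ⟨γ, ?_, ?_⟩)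
  · simp only [Finset.mem_filter, Finset.mem_univ, true_and] at hδ ⊢
    exact hδ.trans h
  · simpa using h
  · simp

lemma rank_lt_card (β : A) : rank β < A.card := by
  have : rank β < (Finset.univ : Finset A).card := by
    refine Finset.card_lt_card ((Finset.ssubset_iff_of_subset (Finset.subset_univ _)).2 ⟨β, ?_, ?_⟩)
    · simp
    · simp
  simpa using this

/-- Along a chain of points with steps of length at most one, the components of `Γ v` grow at most
polynomially in the number of steps; each homogeneity below `β` contributes one factor. -/
lemma norm_skeleton_chain_le {C : ℝ} (hC : 0 ≤ C) (hΓ : SkeletonContinuityWith Γ C)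
    {w : ∀ β, E β} {z : ℕ → Plane} (hz : ∀ k, parabolicDist (z (k + 1)) (z k) ≤ 1) {b : ℝ}
    (hb : 0 ≤ b) (hw : ∀ β, ‖Γ (z 0) w β‖ ≤ b) (β : A) (k : ℕ) :
    ‖Γ (z k) w β‖ ≤ b * ((1 + C) * ((k + 1) * A.card)) ^ rank β := by
  induction hr : rank β using Nat.strong_induction_on generalizing β k with
  | _ r ih =>
    subst hr
    have hA : (1 : ℝ) ≤ A.card := by
      have := rank_lt_card β
      exact_mod_cast (by omega : 1 ≤ A.card)
    have hY : ∀ k : ℕ, (1 : ℝ) ≤ (1 + C) * ((k + 1) * A.card) := fun k => by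
      have h1 : (1 : ℝ) ≤ 1 + C := by linarith
      have h2 : (1 : ℝ) ≤ k + 1 := by simp
      nlinarith [mul_le_mul h2 hA (by norm_num) (by linarith)]
    set Y := (1 + C) * (((k : ℝ) + 1) * A.card) with hYdef
    -- By induction on the rank, each step adds at most `C` times the bound for lower components.
    have hstep : ∀ j : ℕ, j ≤ k → ‖Γ (z j) w β‖ ≤
        b + j * (C * (rank β * (b * Y ^ (rank β - 1)))) := by
      intro j
      induction j with
      | zero => intro _; simpa using hw β
      | succ j ihj =>
        intro hj
        have h1 := hΓ β w (z j) (z (j + 1)) (hz j)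
        have h2 : ∑ γ : A with γ < β,
            parabolicDist (z (j + 1)) (z j) ^ ((β : ℝ) - (γ : ℝ)) * ‖Γ (z j) w γ‖ ≤
            rank β * (b * Y ^ (rank β - 1)) := by
          rw [← nsmul_eq_mul]
          refine Finset.sum_le_card_nsmul _ _ _ fun γ hγ => ?_
          have hγβ : γ < β := by simpa using hγ
          have h3 : parabolicDist (z (j + 1)) (z j) ^ ((β : ℝ) - (γ : ℝ)) ≤ 1 :=
            Real.rpow_le_one (parabolicDist_nonneg _ _) (hz j)
              (sub_nonneg.2 (by exact_mod_cast hγβ.le))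
          have h4 := ih (rank γ) (rank_lt_rank hγβ) γ j rfl
          refine (mul_le_of_le_one_left (norm_nonneg _) h3).trans (h4.trans ?_)
          gcongr
          calc _ ≤ Y ^ rank γ := by
                have := hY j
                rw [hYdef]
                gcongr
                omega
            _ ≤ _ := pow_le_pow_right₀ (hY k) (by have := rank_lt_rank hγβ; omega)
        have h5 : ‖Γ (z (j + 1)) w β‖ ≤ ‖Γ (z j) w β‖ + ‖Γ (z (j + 1)) w β - Γ (z j) w β‖ := by
          simpa using norm_add_le (Γ (z j) w β) (Γ (z (j + 1)) w β - Γ (z j) w β)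
        have h6 := mul_le_mul_of_nonneg_left h2 hC
        have h7 := ihj (by omega)
        push_cast
        linarith
    refine (hstep k le_rfl).trans ?_
    rcases Nat.eq_zero_or_pos (rank β) with h0 | h0
    · simp [h0]
    · have hr : (rank β : ℝ) ≤ A.card := by exact_mod_cast (rank_lt_card β).le
      have hP : (1 : ℝ) ≤ Y ^ (rank β - 1) := one_le_pow₀ (hY k)
      have hY1 : 1 + k * (C * A.card) ≤ Y := by
        rw [hYdef]
        have : (0 : ℝ) ≤ k := by positivity
        nlinarith [mul_nonneg hC (by linarith : (0 : ℝ) ≤ A.card),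
          mul_nonneg this (by linarith : (0 : ℝ) ≤ A.card)]
      calc b + k * (C * (rank β * (b * Y ^ (rank β - 1))))
          ≤ b * Y ^ (rank β - 1) + k * (C * (A.card * (b * Y ^ (rank β - 1)))) := by
            gcongr
            exact le_mul_of_one_le_right hb hP
        _ = (1 + k * (C * A.card)) * (b * Y ^ (rank β - 1)) := by ring
        _ ≤ Y * (b * Y ^ (rank β - 1)) := by gcongr
        _ = b * Y ^ rank β := by
            obtain ⟨m, hm⟩ := Nat.exists_eq_succ_of_ne_zero h0.ne'
            rw [hm, Nat.succ_sub_one, pow_succ]; ring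

/-- The form continuity at distances larger than one, obtained by subdividing the segment between
the points. -/
lemma abs_form_sub_le_of_one_le {C M : ℝ} (hC : 0 ≤ C) (hM : 0 ≤ M)
    (hΓ : SkeletonContinuityWith Γ C) (hV : FormContinuousWith Γ α V M)
    {w : ∀ β, E β} {x y : Plane} {b : ℝ} (hb : 0 ≤ b) (hw : ∀ β, ‖Γ y w β‖ ≤ b)
    (hA : A.Nonempty) (hd : 1 ≤ parabolicDist x y) :
    |V x w - V y w| ≤ M * (1 + C) ^ (A.card - 1) *
      (b * ((13 * A.card) ^ A.card * parabolicDist x y ^ (2 * A.card))) := by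
  set d := parabolicDist x y with hd_def
  have hA1 : 1 ≤ A.card := hA.card_pos
  have hA1' : (1 : ℝ) ≤ A.card := by exact_mod_cast hA1
  -- With this number of steps, the two parts of the parabolic length of a step are at most `1/4`
  -- and `1/2`.
  set N := ⌈4 * (1 + |x 0 - y 0| + |x 1 - y 1|)⌉₊ with hN
  have hNge : 4 * (1 + |x 0 - y 0| + |x 1 - y 1|) ≤ N := Nat.le_ceil _
  have h0 : 0 ≤ |x 0 - y 0| := abs_nonneg _
  have h1 : 0 ≤ |x 1 - y 1| := abs_nonneg _
  have hN0 : (0 : ℝ) < N := by linarith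
  have hN1 : (1 : ℝ) ≤ N := by linarith
  have hNle : (N : ℝ) ≤ 13 * d ^ 2 := by
    have h2 : (N : ℝ) < 4 * (1 + |x 0 - y 0| + |x 1 - y 1|) + 1 :=
      Nat.ceil_lt_add_one (by positivity)
    have h3 : |x 0 - y 0| ≤ d := by
      rw [hd_def, parabolicDist]; linarith [Real.sqrt_nonneg |x 1 - y 1|]
    have h4 : |x 1 - y 1| ≤ d ^ 2 := by
      rw [← Real.sqrt_le_left (by linarith), hd_def, parabolicDist]
      linarith
    nlinarith
  let z : ℕ → Plane := fun k => y + ((k : ℝ) / N) • (x - y)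
  have hz0 : z 0 = y := by simp [z]
  have hzN : z N = x := by simp [z, div_self hN0.ne']
  have hz : ∀ k, parabolicDist (z (k + 1)) (z k) ≤ 1 := by
    intro k
    have e : ∀ i, z (k + 1) i - z k i = (x i - y i) / N := fun i => by
      simp only [z, PiLp.add_apply, PiLp.smul_apply, PiLp.sub_apply, smul_eq_mul]
      push_cast
      ring
    rw [parabolicDist, e, e, abs_div, abs_div, abs_of_pos hN0]
    have h5 : |x 0 - y 0| / N ≤ 1 / 4 := by rw [div_le_iff₀ hN0]; linarith
    have h6 : √(|x 1 - y 1| / N) ≤ 1 / 2 := by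
      rw [Real.sqrt_le_left (by norm_num), div_le_iff₀ hN0]; linarith
    linarith
  have hchain := norm_skeleton_chain_le hC hΓ hz hb (w := w) (by rwa [hz0])
  set Y := (1 + C) * ((N : ℝ) * A.card) with hY
  have hY1 : (1 : ℝ) ≤ Y := by
    have h2 := mul_le_mul hN1 hA1' (by norm_num) (by linarith)
    nlinarith
  have hstep : ∀ k ∈ Finset.range N, |V (z (k + 1)) w - V (z k) w| ≤
      M * (A.card * (b * Y ^ (A.card - 1))) := by
    intro k hk
    refine (hV w (z k) (z (k + 1)) (hz k)).trans ?_
    gcongr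
    have hcard : (A.card : ℝ) = (Finset.univ : Finset A).card := by simp
    rw [hcard, ← nsmul_eq_mul]
    refine Finset.sum_le_card_nsmul _ _ _ fun β _ => ?_
    have h3 : parabolicDist (z (k + 1)) (z k) ^ max (α - (β : ℝ)) 0 ≤ 1 :=
      Real.rpow_le_one (parabolicDist_nonneg _ _) (hz k) (le_max_right _ _)
    refine (mul_le_of_le_one_left (norm_nonneg _) h3).trans ((hchain β k).trans ?_)
    gcongr
    have hkN : (k : ℝ) + 1 ≤ N := by exact_mod_cast Finset.mem_range.1 hk
    calc _ ≤ Y ^ rank β := by rw [hY]; gcongr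
      _ ≤ _ := by
        have := rank_lt_card β
        exact pow_le_pow_right₀ hY1 (by omega)
  have htel : V x w - V y w = ∑ k ∈ Finset.range N, (V (z (k + 1)) w - V (z k) w) := by
    rw [Finset.sum_range_sub (fun k => V (z k) w), hz0, hzN]
  rw [htel]
  refine (Finset.abs_sum_le_sum_abs _ _).trans ((Finset.sum_le_card_nsmul _ _ _ hstep).trans ?_)
  rw [Finset.card_range, nsmul_eq_mul]
  have hp : (N * A.card : ℝ) ^ (A.card - 1) * (N * A.card) = (N * A.card : ℝ) ^ A.card :=
    pow_sub_one_mul (by omega) _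
  calc _ = M * (1 + C) ^ (A.card - 1) * (b * (N * A.card : ℝ) ^ A.card) := by
        rw [← hp, hY, mul_pow]
        generalize ((N : ℝ) * A.card) ^ (A.card - 1) = p
        generalize (1 + C) ^ (A.card - 1) = c
        ring
    _ ≤ M * (1 + C) ^ (A.card - 1) * (b * (13 * d ^ 2 * A.card) ^ A.card) := by
        refine mul_le_mul_of_nonneg_left (mul_le_mul_of_nonneg_left ?_ hb)
          (mul_nonneg hM (pow_nonneg (by linarith) _))
        exact pow_le_pow_left₀ (mul_nonneg hN0.le (Nat.cast_nonneg _))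
          (mul_le_mul_of_nonneg_right hNle (Nat.cast_nonneg _)) _
    _ = _ := by rw [pow_mul, ← mul_pow, mul_right_comm (13 : ℝ)]

end

/-- The parabolic length `|h₁| + √|h₂|`. -/
noncomputable def parabolicLength (h : Plane) : ℝ := |h 0| + √|h 1|

lemma parabolicLength_nonneg (h : Plane) : 0 ≤ parabolicLength h :=
  add_nonneg (abs_nonneg _) (Real.sqrt_nonneg _)

lemma parabolicDist_eq (x y : Plane) : parabolicDist x y = parabolicLength (x - y) := rfl

lemma continuous_parabolicLength : Continuous parabolicLength := by
  unfold parabolicLength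
  fun_prop

lemma parabolicLength_scale {r : ℝ} (hr : 0 < r) (h : Plane) :
    parabolicLength (parabolicScale r hr.ne' h) = r * parabolicLength h := by
  simp only [parabolicLength, parabolicScale_zero, parabolicScale_one, abs_mul, abs_pow,
    abs_of_pos hr]
  rw [Real.sqrt_mul (by positivity), Real.sqrt_sq hr.le]
  ring

lemma parabolicLength_le (h : Plane) : parabolicLength h ≤ 2 * (1 + ‖h‖) := by
  have h0 : |h 0| ≤ ‖h‖ := PiLp.norm_apply_le h 0
  have h1 : |h 1| ≤ ‖h‖ := PiLp.norm_apply_le h 1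
  have h2 : √|h 1| ≤ 1 + |h 1| := by
    rw [Real.sqrt_le_left (by positivity)]
    nlinarith [abs_nonneg (h 1)]
  unfold parabolicLength
  linarith [norm_nonneg h]

/-- The moments of the heat kernel at unit time with respect to the parabolic length. -/
noncomputable def parabolicMoment (p : ℝ) : ℝ := ∫ h, |heatKernel 1 h| * parabolicLength h ^ p

lemma parabolicMoment_nonneg (p : ℝ) : 0 ≤ parabolicMoment p :=
  integral_nonneg fun h =>
    mul_nonneg (abs_nonneg _) (Real.rpow_nonneg (parabolicLength_nonneg h) p)

lemma integrable_parabolicMoment (g : 𝓢(Plane, ℝ)) {p : ℝ} (hp : 0 ≤ p) :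
    Integrable fun h => |g h| * parabolicLength h ^ p := by
  refine integrable_abs_mul g (continuous_parabolicLength.rpow_const fun _ => .inr hp)
    (C := 2 ^ ⌈p⌉₊) (k := ⌈p⌉₊) fun h => ?_
  have h1 : (1 : ℝ) ≤ 2 * (1 + ‖h‖) := by linarith [norm_nonneg h]
  rw [abs_of_nonneg (Real.rpow_nonneg (parabolicLength_nonneg h) p), ← mul_pow,
    ← Real.rpow_natCast]
  exact (Real.rpow_le_rpow (parabolicLength_nonneg h) (parabolicLength_le h) hp).trans
    (Real.rpow_le_rpow_of_exponent_le h1 (Nat.le_ceil p))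

lemma integral_heatKernel_parabolicLength {T : ℝ} (hT : 0 < T) (p : ℝ) :
    ∫ h, |heatKernel T h| * parabolicLength h ^ p = (T ^ (1 / 4 : ℝ)) ^ p * parabolicMoment p := by
  have hr : 0 < T ^ (1 / 4 : ℝ) := Real.rpow_pos_of_pos hT _
  have h1 := integral_abs_heatKernel_mul hr (fun h => parabolicLength h ^ p)
  rw [fourth_root_pow hT.le] at h1
  rw [h1, parabolicMoment, ← integral_const_mul]
  congr 1
  funext h
  rw [parabolicLength_scale hr, Real.mul_rpow hr.le (parabolicLength_nonneg h)]
  ring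

/-! ### The local approximations of a modelled distribution -/

variable {A : Finset ℝ} {E : A → Type*} [∀ β, NormedAddCommGroup (E β)] [∀ β, NormedSpace ℝ (E β)]
  {Γ : Plane → (∀ β, E β) →L[ℝ] (∀ β, E β)} {V : Plane → (∀ β, E β) →L[ℝ] ℝ} {α : ℝ}

/-- The form continuity at all distances, for vectors of homogeneous size `ρ ≤ 1` at `y`. The last
term, in which `κ` is arbitrarily large, accounts for the distances larger than one. -/
lemma abs_form_sub_le {C M : ℝ} (hC : 0 ≤ C) (hM : 0 ≤ M)
    (hΓ : SkeletonContinuityWith Γ C) (hV : FormContinuousWith Γ α V M) (hA : A.Nonempty)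
    {b κ : ℝ} (hb : ∀ β : A, b ≤ β) (hκ : (2 * A.card : ℕ) ≤ κ) {ρ : ℝ} (hρ0 : 0 < ρ) (hρ1 : ρ ≤ 1)
    {w : ∀ β, E β} {y : Plane} (hw : ∀ β : A, ‖Γ y w β‖ ≤ ρ ^ (β : ℝ)) (x : Plane) :
    |V y w - V x w| ≤ M * (1 + C) ^ (A.card - 1) *
      (∑ β : A, parabolicLength (x - y) ^ max (α - (β : ℝ)) 0 * ρ ^ (β : ℝ) +
        (13 * A.card) ^ A.card * ρ ^ b * parabolicLength (x - y) ^ κ) := by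
  have hL := parabolicLength_nonneg (x - y)
  have hsum : 0 ≤ ∑ β : A, parabolicLength (x - y) ^ max (α - (β : ℝ)) 0 * ρ ^ (β : ℝ) :=
    Finset.sum_nonneg fun β _ => mul_nonneg (Real.rpow_nonneg hL _) (Real.rpow_nonneg hρ0.le _)
  have hfar : 0 ≤ (13 * (A.card : ℝ)) ^ A.card * ρ ^ b * parabolicLength (x - y) ^ κ :=
    mul_nonneg (mul_nonneg (by positivity) (Real.rpow_nonneg hρ0.le _)) (Real.rpow_nonneg hL _)
  have hC1 : 1 ≤ (1 + C) ^ (A.card - 1) := one_le_pow₀ (by linarith)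
  rw [abs_sub_comm]
  rcases le_total (parabolicDist x y) 1 with hd | hd
  · refine (hV w y x hd).trans ?_
    refine mul_le_mul (le_mul_of_one_le_right hM hC1) ?_ ?_ (by positivity)
    · refine le_trans (Finset.sum_le_sum fun β _ => ?_) (le_add_of_nonneg_right hfar)
      rw [parabolicDist_eq]
      exact mul_le_mul_of_nonneg_left (hw β) (Real.rpow_nonneg hL _)
    · exact Finset.sum_nonneg fun β _ =>
        mul_nonneg (Real.rpow_nonneg (parabolicDist_nonneg _ _) _) (norm_nonneg _)
  · have hwb : ∀ β, ‖Γ y w β‖ ≤ ρ ^ b := fun β =>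
      (hw β).trans (Real.rpow_le_rpow_of_exponent_ge hρ0 hρ1 (hb β))
    refine (abs_form_sub_le_of_one_le hC hM hΓ hV (Real.rpow_nonneg hρ0.le _) hwb hA hd).trans ?_
    refine mul_le_mul_of_nonneg_left (le_trans ?_ (le_add_of_nonneg_left hsum)) (by positivity)
    have h1 : parabolicDist x y ^ (2 * A.card) ≤ parabolicLength (x - y) ^ κ := by
      rw [← parabolicDist_eq, ← Real.rpow_natCast]
      exact Real.rpow_le_rpow_of_exponent_le hd hκ
    calc _ = (13 * (A.card : ℝ)) ^ A.card * ρ ^ b * parabolicDist x y ^ (2 * A.card) := by ring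
      _ ≤ _ := mul_le_mul_of_nonneg_left h1
        (mul_nonneg (by positivity) (Real.rpow_nonneg hρ0.le _))

/-- The constant in the almost semigroup property of the local approximations. -/
noncomputable def coherenceConst (A : Finset ℝ) (α κ : ℝ) : ℝ :=
  ∑ β : A, parabolicMoment (max (α - (β : ℝ)) 0) + (13 * A.card) ^ A.card * parabolicMoment κ

lemma coherenceConst_nonneg (A : Finset ℝ) (α κ : ℝ) : 0 ≤ coherenceConst A α κ :=
  add_nonneg (Finset.sum_nonneg fun β _ => parabolicMoment_nonneg _)
    (mul_nonneg (by positivity) (parabolicMoment_nonneg _))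

/-- The commutator of the mollification `ψ_s *` with the multiplication by `V`, applied to `v_t`, is
of order `t^{α/4}` for `s ≤ t`: the homogeneities of the factors add up to at least `α`. -/
lemma abs_integral_commutator_le {C M : ℝ} (hC : 0 ≤ C) (hM : 0 ≤ M)
    (hΓ : SkeletonContinuityWith Γ C) (hV : FormContinuousWith Γ α V M) (hA : A.Nonempty)
    {b κ : ℝ} (hb : ∀ β : A, b ≤ β) (hκ : (2 * A.card : ℕ) ≤ κ) (hκα : α ≤ κ + b)
    {s t : ℝ} (hs : 0 < s) (hst : s ≤ t) (ht1 : t ≤ 1) {w : Plane → ∀ β, E β}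
    (hw : ∀ (β : A) y, ‖Γ y (w y) β‖ ≤ (t ^ (1 / 4 : ℝ)) ^ (β : ℝ)) (x : Plane) :
    |∫ y, heatKernel s (x - y) * (V y (w y) - V x (w y))| ≤
      coherenceConst A α κ * (M * (1 + C) ^ (A.card - 1)) * (t ^ (1 / 4 : ℝ)) ^ α := by
  have ht : 0 < t := hs.trans_le hst
  set ρ := t ^ (1 / 4 : ℝ) with hρ
  have hρ0 : 0 < ρ := Real.rpow_pos_of_pos ht _
  have hρ1 : ρ ≤ 1 := Real.rpow_le_one ht.le ht1 (by norm_num)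
  set σ := s ^ (1 / 4 : ℝ) with hσ
  have hσ0 : 0 < σ := Real.rpow_pos_of_pos hs _
  have hσρ : σ ≤ ρ := Real.rpow_le_rpow hs.le hst (by norm_num)
  have hκ0 : 0 ≤ κ := le_trans (by positivity) hκ
  set P := M * (1 + C) ^ (A.card - 1) with hP
  have hP0 : 0 ≤ P := by positivity
  set D : ℝ := (13 * (A.card : ℝ)) ^ A.card with hD
  have hD0 : 0 ≤ D := by positivity
  let G : Plane → ℝ := fun h => P * (∑ β : A, ρ ^ (β : ℝ) *
    (|heatKernel s h| * parabolicLength h ^ max (α - (β : ℝ)) 0) +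
      D * ρ ^ b * (|heatKernel s h| * parabolicLength h ^ κ))
  have hI1 : ∀ β : A, Integrable fun h => ρ ^ (β : ℝ) *
      (|heatKernel s h| * parabolicLength h ^ max (α - (β : ℝ)) 0) := fun β =>
    (integrable_parabolicMoment _ (le_max_right _ _)).const_mul _
  have hI2 : Integrable fun h => D * ρ ^ b * (|heatKernel s h| * parabolicLength h ^ κ) :=
    (integrable_parabolicMoment _ hκ0).const_mul _
  have hI3 := integrable_finsetSum (Finset.univ : Finset A) fun β _ => hI1 β
  have hG : Integrable G := (hI3.add hI2).const_mul P
  have hintG : ∫ h, G h = P * (∑ β : A, ρ ^ (β : ℝ) * (σ ^ max (α - (β : ℝ)) 0 *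
      parabolicMoment (max (α - (β : ℝ)) 0)) + D * ρ ^ b * (σ ^ κ * parabolicMoment κ)) := by
    simp only [G]
    rw [integral_const_mul, integral_add hI3 hI2, integral_finsetSum _ fun β _ => hI1 β]
    simp only [integral_const_mul, integral_heatKernel_parabolicLength hs]
    rw [← hσ]
  have hpt : ∀ y, ‖heatKernel s (x - y) * (V y (w y) - V x (w y))‖ ≤ G (x - y) := by
    intro y
    rw [norm_mul, Real.norm_eq_abs, Real.norm_eq_abs]
    refine (mul_le_mul_of_nonneg_left (abs_form_sub_le hC hM hΓ hV hA hb hκ hρ0 hρ1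
      (fun β => hw β y) x) (abs_nonneg _)).trans (le_of_eq ?_)
    simp only [G]
    rw [← hP, ← hD, mul_left_comm, mul_add, Finset.mul_sum]
    congr 2
    · exact Finset.sum_congr rfl fun β _ => by ring
    · ring
  have h1 := norm_integral_le_of_norm_le (hG.comp_sub_left x) (.of_forall hpt)
  rw [integral_sub_left_eq_self G volume x, hintG, Real.norm_eq_abs] at h1
  refine h1.trans ?_
  have hpow : ∀ p q : ℝ, 0 ≤ p → α ≤ p + q → ρ ^ q * σ ^ p ≤ ρ ^ α := fun p q hp hpq => by
    calc ρ ^ q * σ ^ p ≤ ρ ^ q * ρ ^ p := by gcongr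
      _ = ρ ^ (p + q) := by rw [← Real.rpow_add hρ0, add_comm]
      _ ≤ _ := Real.rpow_le_rpow_of_exponent_ge hρ0 hρ1 hpq
  calc _ ≤ P * (∑ β : A, ρ ^ α * parabolicMoment (max (α - (β : ℝ)) 0) +
        D * (ρ ^ α * parabolicMoment κ)) := by
        refine mul_le_mul_of_nonneg_left (add_le_add (Finset.sum_le_sum fun β _ => ?_) ?_) hP0
        · rw [← mul_assoc]
          refine mul_le_mul_of_nonneg_right (hpow _ _ (le_max_right _ _) ?_)
            (parabolicMoment_nonneg _)
          linarith [le_max_left (α - (β : ℝ)) 0]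
        · rw [mul_assoc, ← mul_assoc (ρ ^ b)]
          exact mul_le_mul_of_nonneg_left (mul_le_mul_of_nonneg_right (hpow _ _ hκ0 hκα)
            (parabolicMoment_nonneg _)) hD0
    _ = _ := by rw [coherenceConst, ← Finset.mul_sum, ← hD]; ring

/-- The local approximation `x ↦ V(x).v_t(x)` is bounded and continuous. -/
lemma exists_localApprox {v : TemperedDist (∀ β, E β)} {b : ℝ} (hb : ∀ β : A, b ≤ β)
    (hv : ∀ (β : A) (x : Plane) (T : ℝ), 0 < T → T ≤ 1 →
      ‖Γ x (mollify v T x) β‖ ≤ (T ^ (1 / 4 : ℝ)) ^ (β : ℝ))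
    (hV : IsModelledDistribution Γ α V) :
    ∃ (B : ℝ) (f : ℝ → Plane →ᵇ ℝ), 0 ≤ B ∧ ∀ t, 0 < t → t ≤ 1 →
      ‖f t‖ ≤ B * t ^ (b / 4) ∧ ∀ x, f t x = V x (mollify v t x) := by
  obtain ⟨M, hM0, hM⟩ := hV.exists_boundedWith
  have hB0 : 0 ≤ ∑ β : A, M β := Finset.sum_nonneg fun β _ => hM0 β
  have hex : ∀ t : ℝ, ∃ f : Plane →ᵇ ℝ, 0 < t → t ≤ 1 →
      ‖f‖ ≤ (∑ β : A, M β) * t ^ (b / 4) ∧ ∀ x, f x = V x (mollify v t x) := by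
    intro t
    by_cases ht : 0 < t ∧ t ≤ 1
    · obtain ⟨ht0, ht1⟩ := ht
      have hbound : ∀ x, ‖V x (mollify v t x)‖ ≤ (∑ β : A, M β) * t ^ (b / 4) := by
        intro x
        refine (hM _ x).trans ?_
        rw [Finset.sum_mul]
        refine Finset.sum_le_sum fun β _ => mul_le_mul_of_nonneg_left ?_ (hM0 β)
        refine (hv β x t ht0 ht1).trans ?_
        rw [← Real.rpow_mul ht0.le]
        exact Real.rpow_le_rpow_of_exponent_ge ht0 ht1 (by linarith [hb β])
      exact ⟨BoundedContinuousFunction.ofNormedAddCommGroup (fun x => V x (mollify v t x))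
        (hV.continuous.clm_apply (continuous_mollify v t)) _ hbound, fun _ _ =>
        ⟨BoundedContinuousFunction.norm_ofNormedAddCommGroup_le _
          (mul_nonneg hB0 (Real.rpow_nonneg ht0.le _)) _, fun _ => rfl⟩⟩
    · exact ⟨0, fun h0 h1 => absurd ⟨h0, h1⟩ ht⟩
  choose f hf using hex
  exact ⟨_, f, hB0, hf⟩

/-- The difference between the two ways of increasing the scale from `t` to `s + t` is a
commutator. -/
lemma mollify_sub_form_eq_integral {v : TemperedDist (∀ β, E β)} {s t : ℝ} (hs : 0 < s)
    (ht : 0 < t) {f : Plane →ᵇ ℝ} (hf : ∀ x, f x = V x (mollify v t x)) (x : Plane) :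
    mollify (boundedDist f) s x - V x (mollify v (s + t) x) =
      ∫ y, heatKernel s (x - y) * (V y (mollify v t y) - V x (mollify v t y)) := by
  let u : TemperedDist ℝ := (V x).comp v
  have h1 : V x (mollify v (s + t) x) = ∫ y, heatKernelAt s x y * mollify u t y := by
    simp_rw [heatKernelAt_apply]
    exact mollify_add u hs ht x
  have h2 : mollify (boundedDist f) s x = ∫ y, heatKernelAt s x y * f y := by
    rw [mollify, boundedDist_apply]
    simp_rw [mul_comm]
  have hi : Integrable fun y => heatKernelAt s x y * f y := by
    simpa only [mul_comm] using integrable_bcf_mul f (heatKernelAt s x)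
  rw [h1, h2, ← integral_sub hi (integrable_mul_mollify u t _)]
  congr 1
  funext y
  rw [← mul_sub, heatKernelAt_apply, hf]
  rfl

end Reconstruction

open Reconstruction

theorem proposition2p4 (A : Finset ℝ) (hA : A.Nonempty)
    (hmin : A.min' hA ∈ Set.Ioo (-4 : ℝ) 0) (α : ℝ) (hα : 0 < α) :
    ∃ C : ℝ, 0 < C ∧
      ∀ (E : A → Type*) [∀ β, NormedAddCommGroup (E β)] [∀ β, NormedSpace ℝ (E β)]
        [∀ β, CompleteSpace (E β)]
        (Γ : Plane → (∀ β, E β) →L[ℝ] (∀ β, E β)), IsSkeleton Γ →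
      ∀ v : TemperedDist (∀ β, E β),
        (∀ (β : A) (x : Plane) (T : ℝ), 0 < T → T ≤ 1 →
          ‖Γ x (mollify v T x) β‖ ≤ (T ^ (1 / 4 : ℝ)) ^ (β : ℝ)) →
      ∀ V : Plane → (∀ β, E β) →L[ℝ] ℝ, IsModelledDistribution Γ α V →
      ∃ R : TemperedDist ℝ,
        (∀ (T : ℝ) (x : Plane), 0 < T → T ≤ 1 →
          |mollify R T x - V x (mollify v T x)| ≤
            C * (1 + skeletonNorm Γ) ^ (A.card - 1) * formSeminorm Γ α V
              * (T ^ (1 / 4 : ℝ)) ^ α) ∧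
        ∀ (R' : TemperedDist ℝ) (C' : ℝ),
          (∀ (T : ℝ) (x : Plane), 0 < T → T ≤ 1 →
            |mollify R' T x - V x (mollify v T x)| ≤ C' * (T ^ (1 / 4 : ℝ)) ^ α) →
          R' = R := by
  obtain ⟨C₁, hC₁, hrec⟩ := exists_temperedDist_of_almost_semigroup α hα
  set b := A.min' hA with hb
  have hbβ : ∀ β : A, b ≤ β := fun β => A.min'_le _ β.2
  set κ : ℝ := max (2 * A.card : ℕ) (α - b) with hκ
  have hκ1 : ((2 * A.card : ℕ) : ℝ) ≤ κ := le_max_left _ _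
  have hκ2 : α ≤ κ + b := by linarith [le_max_right ((2 * A.card : ℕ) : ℝ) (α - b)]
  have hK₀ := coherenceConst_nonneg A α κ
  refine ⟨C₁ * (coherenceConst A α κ + 1), by positivity, ?_⟩
  intro E _ _ _ Γ hΓ v hv V hV
  have hN0 : 0 ≤ skeletonNorm Γ := skeletonNorm_nonneg
  have hS0 : 0 ≤ formSeminorm Γ α V := formSeminorm_nonneg
  have hroot : ∀ t : ℝ, 0 < t → (t ^ (1 / 4 : ℝ)) ^ α = t ^ (α / 4) := fun t ht => by
    rw [← Real.rpow_mul ht.le]; ring_nf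
  obtain ⟨B, f, hB0, hf⟩ := exists_localApprox hbβ hv hV
  obtain ⟨R, hR⟩ := hrec f b B (coherenceConst A α κ *
    (formSeminorm Γ α V * (1 + skeletonNorm Γ) ^ (A.card - 1))) hmin.1 hB0 (by positivity)
    (fun t ht ht1 => (hf t ht ht1).1) (fun s t x hs hst hst1 => by
      have ht : 0 < t := hs.trans_le hst
      have ht1 : t ≤ 1 := by linarith
      rw [(hf (s + t) (by linarith) hst1).2, ← hroot t ht,
        mollify_sub_form_eq_integral hs ht (hf t ht ht1).2]
      exact abs_integral_commutator_le hN0 hS0 (skeletonContinuityWith_skeletonNorm hΓ)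
        (formContinuousWith_formSeminorm hV) hA hbβ hκ1 hκ2 hs hst ht1
        (fun β y => hv β y t ht ht1) x)
  have hR' : ∀ (T : ℝ) (x : Plane), 0 < T → T ≤ 1 →
      |mollify R T x - V x (mollify v T x)| ≤
        C₁ * (coherenceConst A α κ + 1) * (1 + skeletonNorm Γ) ^ (A.card - 1) *
          formSeminorm Γ α V * (T ^ (1 / 4 : ℝ)) ^ α := by
    intro T x hT hT1
    have h1 := hR T x hT hT1
    rw [(hf T hT hT1).2, ← hroot T hT] at h1
    refine h1.trans ?_
    have hTα : 0 ≤ (T ^ (1 / 4 : ℝ)) ^ α := by positivity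
    calc _ = C₁ * coherenceConst A α κ * (1 + skeletonNorm Γ) ^ (A.card - 1) *
          formSeminorm Γ α V * (T ^ (1 / 4 : ℝ)) ^ α := by ring
      _ ≤ _ := by
          gcongr
          linarith
  refine ⟨R, hR', fun R' C' hR'' => ?_⟩
  rw [← sub_eq_zero]
  refine eq_zero_of_mollify_le hα (C := C' + C₁ * (coherenceConst A α κ + 1) *
    (1 + skeletonNorm Γ) ^ (A.card - 1) * formSeminorm Γ α V) fun T x hT hT1 => ?_
  rw [mollify_sub, add_mul]
  refine (abs_sub_le _ (V x (mollify v T x)) _).trans (add_le_add (hR'' T x hT hT1) ?_)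
  rw [abs_sub_comm]
  exact hR' T x hT hT1
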